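/- Let $T>0$, let $H$ be a separable real Hilbert space and let $(\Omega,\mathcal F,P,(\mathcal F_t)_{t\in[0,T]})$ be a filtered probability space. Let $D([0,T];H)$ be the space of càdlàg functions $[0,T]\to H$ with the Skorokhod topology, that is, the topology of the metric $$d(x,y)=\inf_{j}\Big(\sup_{t\in[0,T]}|t-j(t)|\ \vee\ \sup_{t\in[0,T]}\|x(t)-y(j(t))\|\Big),$$ where $j$ runs through the increasing bijections of $[0,T]$, and with its Borel $\sigma$-algebra. Let $(X_n)_{n\in\mathbb N}$ be a sequence of $H$-valued càdlàg processes on $[0,T]$ adapted to $(\mathcal F_t)$. Assume: (1) (Aldous condition) for all $\epsilon,\eta>0$ there exists $\delta>0$ such that for all sequences $(\tau_n)$ of stopping times with $\tau_n\le T$ one has $$\sup_{n\in\mathbb N}\ \sup_{0<\theta\le\delta}P\big(\|X_n((\tau_n+\theta)\wedge T)-X_n(\tau_n)\|\ge\eta\big)\le\epsilon ;$$ (2) there exists a compactly embedded subspace $\Gamma$ of $H$ (a linear subspace with its own norm $\|\cdot\|_\Gamma$ such that the inclusion $\Gamma\hookrightarrow H$ is a compact operator) such that $$\forall\,\epsilon>0\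 \exists\, R>0\ \forall\, t\in[0,T]\cap\mathbb Q,\ n\in\mathbb N:\quad P\big(X_n(t)\in\Gamma\text{ and }\|X_n(t)\|_\Gamma\le R\big)\ge 1-\epsilon .$$ Then each $X_n$ is a random variable with values in $D([0,T];H)$, and $(X_n)$ is tight in $D([0,T];H)$: for every $\epsilon>0$ there is a compact set $K\subset D([0,T];H)$ with $P(X_n\in K)\ge 1-\epsilon$ for all $n$. -/

import Mathlib

open MeasureTheory Filter Topology
open scoped ENNReal

/-- A function on `[0,T]` is càdlàg if it is right-continuous with left limits. -/
def IsCadlagOn {T : ℝ} {H : Type*} [TopologicalSpace H] (x : Set.Icc (0 : ℝ) T → H) : Prop :=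
  (∀ t, ContinuousWithinAt x (Set.Ici t) t) ∧ ∀ t, ∃ l, Tendsto x (𝓝[<] t) (𝓝 l)

/-- The Skorokhod space `D([0,T];H)`: the càdlàg functions from `[0,T]` to `H`. -/
@[ext]
structure SkorokhodSpace (T : ℝ) (H : Type*) [TopologicalSpace H] where
  /-- the underlying function -/
  toFun : Set.Icc (0 : ℝ) T → H
  /-- the underlying function is càdlàg -/
  cadlag : IsCadlagOn toFun

namespace SkorokhodSpace

variable {T : ℝ} {H : Type*} [PseudoEMetricSpace H]

/-- `max (sup_t |t - j t|) (sup_t |x t - y (j t)|)`, for a time change `j` of `[0,T]`. -/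
noncomputable def distortion (x y : SkorokhodSpace T H)
    (j : Set.Icc (0 : ℝ) T ≃o Set.Icc (0 : ℝ) T) : ℝ≥0∞ :=
  (⨆ t, edist t (j t)) ⊔ ⨆ t, edist (x.toFun t) (y.toFun (j t))

lemma distortion_refl (x : SkorokhodSpace T H) : distortion x x (OrderIso.refl _) = 0 := by
  simp [distortion]

lemma distortion_symm_le (x y : SkorokhodSpace T H)
    (j : Set.Icc (0 : ℝ) T ≃o Set.Icc (0 : ℝ) T) :
    distortion y x j.symm ≤ distortion x y j := by
  refine sup_le_sup (iSup_le fun t => ?_) (iSup_le fun t => ?_)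
  · refine le_trans (le_of_eq ?_) (le_iSup (fun s => edist s (j s)) (j.symm t))
    rw [j.apply_symm_apply, edist_comm]
  · refine le_trans (le_of_eq ?_)
      (le_iSup (fun s => edist (x.toFun s) (y.toFun (j s))) (j.symm t))
    rw [j.apply_symm_apply, edist_comm]

lemma distortion_trans_le (x y z : SkorokhodSpace T H)
    (j k : Set.Icc (0 : ℝ) T ≃o Set.Icc (0 : ℝ) T) :
    distortion x z (j.trans k) ≤ distortion x y j + distortion y z k := by
  refine sup_le (iSup_le fun t => ?_) (iSup_le fun t => ?_)
  · refine (edist_triangle t (j t) (k (j t))).trans (add_le_add ?_ ?_)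
    · exact (le_iSup (fun s => edist s (j s)) t).trans le_sup_left
    · exact (le_iSup (fun s => edist s (k s)) (j t)).trans le_sup_left
  · refine (edist_triangle (x.toFun t) (y.toFun (j t)) (z.toFun (k (j t)))).trans
      (add_le_add ?_ ?_)
    · exact (le_iSup (fun s => edist (x.toFun s) (y.toFun (j s))) t).trans le_sup_right
    · exact (le_iSup (fun s => edist (y.toFun s) (z.toFun (k s))) (j t)).trans le_sup_right

/-- The Skorokhod metric
`d(x,y) = inf_j max (sup_t |t - j t|) (sup_t |x t - y (j t)|)`, where `j` runs through the
increasing bijections of `[0,T]`; it induces the Skorokhod (J1) topology. -/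
noncomputable instance : PseudoEMetricSpace (SkorokhodSpace T H) where
  edist x y := ⨅ j : Set.Icc (0 : ℝ) T ≃o Set.Icc (0 : ℝ) T, distortion x y j
  edist_self x := le_antisymm ((iInf_le _ (OrderIso.refl _)).trans_eq (distortion_refl x)) bot_le
  edist_comm x y := le_antisymm
    (le_iInf fun j => (iInf_le _ j.symm).trans (distortion_symm_le y x j))
    (le_iInf fun j => (iInf_le _ j.symm).trans (distortion_symm_le x y j))
  edist_triangle x y z := by
    simp only [ENNReal.iInf_add, ENNReal.add_iInf]
    exact le_iInf fun j => le_iInf fun k =>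
      (iInf_le _ _).trans (distortion_trans_le x y z _ _)

/-- `D([0,T];H)` carries the Borel σ-algebra of the Skorokhod topology. -/
noncomputable instance : MeasurableSpace (SkorokhodSpace T H) := borel _

instance : BorelSpace (SkorokhodSpace T H) := ⟨rfl⟩

end SkorokhodSpace

/-- The Aldous condition for a sequence of processes on `[0,T]`: for all `ε, η > 0` there is
`δ > 0` such that for every sequence of stopping times `τ n ≤ T`, every `n` and every
`0 < θ ≤ δ`, the probability of `‖X n ((τ n + θ) ∧ T) - X n (τ n)‖ ≥ η` is at most `ε`.
Here `Set.projIcc 0 T hT s` is `s ∧ T` for `s ≥ 0`. -/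
def AldousCondition {Ω H : Type*} {mΩ : MeasurableSpace Ω} [NormedAddCommGroup H]
    {T : ℝ} (hT : 0 ≤ T) (P : Measure Ω) (𝓕 : Filtration (Set.Icc (0 : ℝ) T) mΩ)
    (X : ℕ → Set.Icc (0 : ℝ) T → Ω → H) : Prop :=
  ∀ ε : ℝ, 0 < ε → ∀ η : ℝ, 0 < η → ∃ δ : ℝ, 0 < δ ∧
    ∀ τ : ℕ → Ω → Set.Icc (0 : ℝ) T,
      (∀ n, IsStoppingTime 𝓕 fun ω => ((τ n ω : Set.Icc (0 : ℝ) T) : WithTop (Set.Icc (0 : ℝ) T))) →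
      ∀ n, ∀ θ : ℝ, 0 < θ → θ ≤ δ →
        P.real {ω | η ≤ ‖X n (Set.projIcc 0 T hT ((τ n ω : ℝ) + θ)) ω - X n (τ n ω) ω‖} ≤ ε

/-- Containment in balls of a space `Γ` embedded into `H` by `i`: for every `ε > 0` there is
`R > 0` such that, for all rational `t` in `[0,T]` and all `n`, with probability at least
`1 - ε` the value `X n t` lies in `Γ` and has `Γ`-norm at most `R`. -/
def BallContainment {Ω H Γ : Type*} {mΩ : MeasurableSpace Ω} [NormedAddCommGroup H]
    [NormedSpace ℝ H] [NormedAddCommGroup Γ] [NormedSpace ℝ Γ] {T : ℝ} (P : Measure Ω)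
    (i : Γ →ₗ[ℝ] H) (X : ℕ → Set.Icc (0 : ℝ) T → Ω → H) : Prop :=
  ∀ ε : ℝ, 0 < ε → ∃ R : ℝ, 0 < R ∧
    ∀ q : ℚ, ∀ hq : (q : ℝ) ∈ Set.Icc (0 : ℝ) T, ∀ n,
      1 - ε ≤ P.real {ω | ∃ g : Γ, i g = X n ⟨(q : ℝ), hq⟩ ω ∧ ‖g‖ ≤ R}

/-! All probabilistic estimates are made on the grids `p T / M`, uniformly in `M`, so no hitting
times in continuous time are needed. Sampling a càdlàg path on a grid gives a step function, and
samples on finer grids converge to the path in the Skorokhod topology (`tendsto_sample`). A sample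
depends continuously on finitely many values of the path, whence measurability. A path outside a
closed set has all its fine samples outside that set, so a bound for the samples that is uniform in
`M` also bounds the paths.

The compact sets consist of the functions that, for each `k`, are uniformly within `c k → 0` of a
step function with gaps at least `δ k` and values in a compact `C k`. Such step functions form a
compact set (`isCompact_stepsIn`). Uniform bounds between them survive Skorokhod limits, so the
limits of the approximants are uniformly Cauchy and their uniform limit is the required limit point
(`isCompact_setOf_forall_exists_edist_le`).

Partitions with long gaps come from successive exit times of the sampled process. Aldous's averaging
argument (`measure_dist_le_of_isGridTime`) passes from deterministic lags after one stopping time to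
two stopping times close together: if the process differs by `2 η` between them, then at every later
time it is `η` away from one of the two values. Counting the lags bounds the probability. Hence the
number of exits is bounded with high probability (`measure_exitIndex_lt`), and then so, from below,
are the gaps.

Values in a compact set are needed only at boundedly many times, one in each gap. Ball containment
supplies them at times before `T`, by right continuity; the value at `T` is controlled by the Aldous
condition. -/

/-! ### Time changes between finite partitions -/

/-- A point lying between the ends of a finite sequence lies between two consecutive terms. -/
lemma exists_between_consecutive {α : Type*} [LinearOrder α] {t : ℕ → α} {N : ℕ} {s : α}
    (h0 : t 0 ≤ s) (hN : s < t N) : ∃ i < N, t i ≤ s ∧ s < t (i + 1) := by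
  induction N with
  | zero => exact absurd hN (not_lt.2 h0)
  | succ N ih =>
    rcases lt_or_ge s (t N) with h | h
    · obtain ⟨i, hi, hs⟩ := ih h
      exact ⟨i, hi.trans (Nat.lt_succ_self N), hs⟩
    · exact ⟨N, Nat.lt_succ_self N, h, hN⟩

lemma le_of_lt_consecutive {α : Type*} [Preorder α] {t : ℕ → α} {N : ℕ}
    (ht : ∀ i < N, t i < t (i + 1)) {i k : ℕ} (hik : i ≤ k) (hk : k ≤ N) : t i ≤ t k := by
  induction k, hik using Nat.le_induction with
  | base => exact le_rfl
  | succ k hik ih => exact (ih (by omega)).trans (ht k (by omega)).le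

/-- The piecewise linear time change carrying a partition to another one. -/
lemma exists_timeChange {T : ℝ} {N : ℕ} {t u : ℕ → Set.Icc (0 : ℝ) T}
    (ht0 : (t 0 : ℝ) = 0) (hu0 : (u 0 : ℝ) = 0) (htN : (t N : ℝ) = T) (huN : (u N : ℝ) = T)
    (ht : ∀ i < N, t i < t (i + 1)) (hu : ∀ i < N, u i < u (i + 1)) {r : ℝ}
    (hr : ∀ i ≤ N, |(u i : ℝ) - t i| ≤ r) :
    ∃ j : Set.Icc (0 : ℝ) T ≃o Set.Icc (0 : ℝ) T,
      (∀ i ≤ N, j (t i) = u i) ∧ ∀ s, |(j s : ℝ) - s| ≤ 2 * N * r := by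
  have ht' : ∀ i < N, (t i : ℝ) < t (i + 1) := ht
  have hu' : ∀ i < N, (u i : ℝ) < u (i + 1) := hu
  -- `ramp i` climbs linearly from 0 to 1 between `t i` and `t (i + 1)`; weighting the ramps by the
  -- increments of `u` interpolates the partition `u`.
  let ramp : ℕ → ℝ → ℝ := fun i s => (min s (t (i + 1)) - min s (t i)) / ((t (i + 1) : ℝ) - t i)
  let f : ℝ → ℝ := fun s => ∑ i ∈ Finset.range N, ((u (i + 1) : ℝ) - u i) * ramp i s
  have ramp_mono : ∀ i < N, Monotone (ramp i) := by
    intro i hi a b hab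
    have := ht' i hi
    refine div_le_div_of_nonneg_right ?_ (by linarith)
    rcases min_cases a (t (i + 1) : ℝ) with h | h <;> rcases min_cases a (t i : ℝ) with h' | h' <;>
    rcases min_cases b (t (i + 1) : ℝ) with h'' | h'' <;>
    rcases min_cases b (t i : ℝ) with h3 | h3 <;> linarith
  have ramp_zero : ∀ i < N, ∀ s : ℝ, s ≤ t i → ramp i s = 0 := by
    intro i hi s hs
    simp [ramp, min_eq_left hs, min_eq_left (hs.trans (ht' i hi).le)]
  have ramp_one : ∀ i < N, ∀ s : ℝ, t (i + 1) ≤ s → ramp i s = 1 := by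
    intro i hi s hs
    have := ht' i hi
    simp only [ramp, min_eq_right hs, min_eq_right (this.le.trans hs)]
    exact div_self (by linarith)
  have ramp_abs : ∀ i < N, ∀ s : ℝ, |ramp i s| ≤ 1 := by
    intro i hi s
    have h0 : 0 ≤ ramp i s := by
      rw [← ramp_zero i hi (min s (t i)) (min_le_right _ _)]
      exact ramp_mono i hi (min_le_left _ _)
    have h1 : ramp i s ≤ 1 := by
      rw [← ramp_one i hi (max s (t (i + 1))) (le_max_right _ _)]
      exact ramp_mono i hi (le_max_left _ _)
    rwa [abs_of_nonneg h0]
  have f_mono : Monotone f := fun a b hab => Finset.sum_le_sum fun i hi =>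
    mul_le_mul_of_nonneg_left (ramp_mono i (Finset.mem_range.1 hi) hab)
      (by linarith [hu' i (Finset.mem_range.1 hi)])
  have f_strict : ∀ a b : ℝ, 0 ≤ a → a < b → b ≤ T → f a < f b := by
    intro a b ha hab hb
    obtain ⟨i, hi, h1, h2⟩ := exists_between_consecutive (t := fun i => (t i : ℝ)) (N := N) (s := a)
      (by simpa [ht0] using ha) (by simpa [htN] using hab.trans_le hb)
    refine Finset.sum_lt_sum (fun i hi => mul_le_mul_of_nonneg_left
      (ramp_mono i (Finset.mem_range.1 hi) hab.le)
      (by linarith [hu' i (Finset.mem_range.1 hi)])) ⟨i, Finset.mem_range.2 hi, ?_⟩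
    refine mul_lt_mul_of_pos_left ?_ (by linarith [hu' i hi])
    refine div_lt_div_of_pos_right ?_ (by linarith [ht' i hi])
    rw [min_eq_left h2.le, min_eq_right h1, min_eq_right (h1.trans hab.le)]
    have := lt_min hab h2
    linarith
  have f_eq : ∀ k ≤ N, f (t k) = u k := by
    intro k hk
    have h1 : ∑ i ∈ Finset.range k, ((u (i + 1) : ℝ) - u i) = f (t k) := by
      refine (Finset.sum_congr rfl fun i hi => ?_).trans
        (Finset.sum_subset (Finset.range_mono hk) fun i hi hi' => ?_)
      · have hi := Finset.mem_range.1 hi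
        rw [ramp_one i (by omega) _ (le_of_lt_consecutive ht (by omega) hk), mul_one]
      · have hi := Finset.mem_range.1 hi
        rw [ramp_zero i hi _ (le_of_lt_consecutive ht (by simpa using hi') hi.le), mul_zero]
    rw [← h1, Finset.sum_range_sub (fun i => (u i : ℝ)), hu0, sub_zero]
  have f_disp : ∀ s : ℝ, 0 ≤ s → s ≤ T → |f s - s| ≤ 2 * N * r := by
    intro s h0 hT
    -- With the increments of `t` as weights the ramps add up to the identity, so `f s - s` is a sum
    -- of `N` terms of size at most `2 * r`.
    have hs : ∑ i ∈ Finset.range N, ((t (i + 1) : ℝ) - t i) * ramp i s = s := by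
      have : ∀ i ∈ Finset.range N, ((t (i + 1) : ℝ) - t i) * ramp i s
          = min s (t (i + 1)) - min s (t i) := by
        intro i hi
        have := ht' i (Finset.mem_range.1 hi)
        exact mul_div_cancel₀ _ (by linarith)
      rw [Finset.sum_congr rfl this, Finset.sum_range_sub (fun i => min s (t i : ℝ)), ht0, htN,
        min_eq_left hT, min_eq_right h0, sub_zero]
    have h2 : f s - s = ∑ i ∈ Finset.range N,
        (((u (i + 1) : ℝ) - t (i + 1)) - ((u i : ℝ) - t i)) * ramp i s := by
      nth_rw 2 [← hs]
      rw [← Finset.sum_sub_distrib]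
      exact Finset.sum_congr rfl fun i _ => by ring
    rw [h2]
    refine (Finset.abs_sum_le_sum_abs _ _).trans
      ((Finset.sum_le_card_nsmul _ _ (2 * r) fun i hi => ?_).trans (le_of_eq ?_))
    · have hi := Finset.mem_range.1 hi
      rw [abs_mul]
      have h3 := (abs_sub ((u (i + 1) : ℝ) - t (i + 1)) ((u i : ℝ) - t i)).trans
        (add_le_add (hr (i + 1) hi) (hr i hi.le))
      calc _ ≤ (r + r) * 1 := mul_le_mul h3 (ramp_abs i hi s) (abs_nonneg _)
            ((abs_nonneg _).trans h3)
        _ = 2 * r := by ring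
    · simp; ring
  have f0 : f 0 = 0 := by simpa [ht0, hu0] using f_eq 0 (Nat.zero_le _)
  have fT : f T = T := by simpa [htN, huN] using f_eq N le_rfl
  have f_cont : Continuous f := by fun_prop
  let g : Set.Icc (0 : ℝ) T → Set.Icc (0 : ℝ) T := fun s =>
    ⟨f s, by simpa [f0] using f_mono s.2.1, by simpa [fT] using f_mono s.2.2⟩
  have g_strict : StrictMono g := fun a b hab => f_strict a b a.2.1 hab b.2.2
  have g_surj : Function.Surjective g := by
    intro y
    have hT : (0 : ℝ) ≤ T := y.2.1.trans y.2.2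
    obtain ⟨s, hs, hsy⟩ := intermediate_value_Icc hT f_cont.continuousOn
      (show (y : ℝ) ∈ Set.Icc (f 0) (f T) by rw [f0, fT]; exact y.2)
    exact ⟨⟨s, hs⟩, Subtype.ext hsy⟩
  refine ⟨g_strict.orderIsoOfSurjective g g_surj, fun i hi => ?_, fun s => ?_⟩
  · exact Subtype.ext (f_eq i hi)
  · exact f_disp s s.2.1 s.2.2

/-! ### Step functions -/

/-- The number of the points `t 1, …, t N` that are at most `s`. -/
def countLE {α : Type*} [LinearOrder α] (N : ℕ) (t : ℕ → α) (s : α) : ℕ :=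
  ((Finset.range N).filter fun i => t (i + 1) ≤ s).card

section countLE

variable {α : Type*} [LinearOrder α] {N : ℕ} {t : ℕ → α}

lemma countLE_le (s : α) : countLE N t s ≤ N :=
  (Finset.card_filter_le _ _).trans_eq (Finset.card_range N)

lemma countLE_eq (ht : ∀ i < N, t i < t (i + 1)) {k : ℕ} (hk : k < N) {s : α}
    (h1 : t k ≤ s) (h2 : s < t (k + 1)) : countLE N t s = k := by
  have : ((Finset.range N).filter fun i => t (i + 1) ≤ s) = Finset.range k := by
    ext i
    simp only [Finset.mem_filter, Finset.mem_range]
    refine ⟨fun ⟨hi, h⟩ => ?_, fun hi => ⟨by omega, ?_⟩⟩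
    · by_contra hik
      exact absurd (h2.trans_le ((le_of_lt_consecutive ht (by omega : k + 1 ≤ i + 1) hi).trans h))
        (lt_irrefl _)
    · exact (le_of_lt_consecutive ht (by omega : i + 1 ≤ k) hk.le).trans h1
  rw [countLE, this, Finset.card_range]

lemma countLE_eq_last (ht : ∀ i < N, t i < t (i + 1)) {s : α} (h : t N ≤ s) :
    countLE N t s = N := by
  rw [countLE, Finset.filter_true_of_mem, Finset.card_range]
  intro i hi
  exact (le_of_lt_consecutive ht (Finset.mem_range.1 hi) le_rfl).trans h

/-- An order isomorphism carrying `t` to `u` preserves these comparisons; this is how step functions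
on two partitions are matched. -/
lemma countLE_congr {u : ℕ → α} {s s' : α} (h : ∀ i < N, (t (i + 1) ≤ s ↔ u (i + 1) ≤ s')) :
    countLE N t s = countLE N u s' :=
  congrArg Finset.card (Finset.filter_congr fun i hi => h i (Finset.mem_range.1 hi))

variable [TopologicalSpace α] [OrderTopology α]

lemma eventually_countLE_eq (N : ℕ) (t : ℕ → α) (s : α) :
    ∀ᶠ s' in 𝓝[≥] s, countLE N t s' = countLE N t s := by
  have : ∀ i ∈ Finset.range N, ∀ᶠ s' in 𝓝[≥] s, (t (i + 1) ≤ s' ↔ t (i + 1) ≤ s) := by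
    intro i _
    rcases le_or_gt (t (i + 1)) s with h | h
    · filter_upwards [self_mem_nhdsWithin] with s' hs'
      exact iff_of_true (h.trans hs') h
    · filter_upwards [mem_nhdsWithin_of_mem_nhds (Iio_mem_nhds h)] with s' hs'
      exact iff_of_false (not_le.2 hs') (not_le.2 h)
  filter_upwards [(Finset.eventually_all _).2 this] with s' hs'
  exact countLE_congr fun i hi => hs' i (Finset.mem_range.2 hi)

lemma exists_eventually_countLE_eq (N : ℕ) (t : ℕ → α) (s : α) :
    ∃ k, ∀ᶠ s' in 𝓝[<] s, countLE N t s' = k := by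
  have : ∀ i ∈ Finset.range N, ∀ᶠ s' in 𝓝[<] s, (t (i + 1) ≤ s' ↔ t (i + 1) < s) := by
    intro i _
    rcases lt_or_ge (t (i + 1)) s with h | h
    · filter_upwards [mem_nhdsWithin_of_mem_nhds (Ioi_mem_nhds h)] with s' hs'
      exact iff_of_true (le_of_lt hs') h
    · filter_upwards [self_mem_nhdsWithin] with s' hs'
      exact iff_of_false (not_le.2 (lt_of_lt_of_le hs' h)) (not_lt.2 h)
  refine ⟨((Finset.range N).filter fun i => t (i + 1) < s).card, ?_⟩
  filter_upwards [(Finset.eventually_all _).2 this] with s' hs'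
  exact congrArg Finset.card (Finset.filter_congr hs')

end countLE

namespace SkorokhodSpace

variable {T : ℝ} {H : Type*}

/-- The step function with value `v k` between `t k` and `t (k + 1)` for `k < N`, and with
value `v N` from `t N` on. -/
noncomputable def step [TopologicalSpace H] (N : ℕ) (t : ℕ → Set.Icc (0 : ℝ) T) (v : ℕ → H) :
    SkorokhodSpace T H where
  toFun s := v (countLE N t s)
  cadlag := by
    refine ⟨fun s => ?_, fun s => ?_⟩
    · refine tendsto_const_nhds.congr' ?_
      filter_upwards [eventually_countLE_eq N t s] with s' hs'
      rw [hs']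
    · obtain ⟨k, hk⟩ := exists_eventually_countLE_eq N t s
      refine ⟨v k, tendsto_const_nhds.congr' ?_⟩
      filter_upwards [hk] with s' hs'
      rw [hs']

/-- There are finitely many jumps, so the index is constant on some interval just to the right of
`s`, hence locally constant at each interior point of it. -/
lemma eventually_continuousAt_step [TopologicalSpace H] (N : ℕ) (t : ℕ → Set.Icc (0 : ℝ) T)
    (v : ℕ → H) (s : Set.Icc (0 : ℝ) T) :
    ∀ᶠ s' in 𝓝[>] s, ContinuousAt (step N t v).toFun s' := by
  have h : ∀ᶠ s' in 𝓝[>] s, countLE N t s' = countLE N t s :=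
    nhdsWithin_mono _ Set.Ioi_subset_Ici_self (eventually_countLE_eq N t s)
  filter_upwards [eventually_eventually_nhdsWithin.2 h, self_mem_nhdsWithin] with s' h1 h2
  rw [isOpen_Ioi.nhdsWithin_eq h2] at h1
  have h3 : ∀ᶠ a in 𝓝 s', (step N t v).toFun a = v (countLE N t s) := by
    filter_upwards [h1] with a ha
    exact congrArg v ha
  exact continuousAt_const.congr (h3.mono fun _ h => h.symm)

/-! ### Skorokhod limits and a compactness criterion -/

variable [PseudoEMetricSpace H]

lemma edist_le_of_timeChange {x y : SkorokhodSpace T H} {c : ℝ≥0∞}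
    (j : Set.Icc (0 : ℝ) T ≃o Set.Icc (0 : ℝ) T) (h1 : ∀ t, edist t (j t) ≤ c)
    (h2 : ∀ t, edist (x.toFun t) (y.toFun (j t)) ≤ c) : edist x y ≤ c :=
  (iInf_le _ j).trans (sup_le (iSup_le h1) (iSup_le h2))

lemma edist_le_of_forall {x y : SkorokhodSpace T H} {c : ℝ≥0∞}
    (h : ∀ t, edist (x.toFun t) (y.toFun t) ≤ c) : edist x y ≤ c :=
  edist_le_of_timeChange (OrderIso.refl _) (by simp) (by simpa using h)

lemma exists_timeChange_of_edist_lt {x y : SkorokhodSpace T H} {c : ℝ≥0∞} (h : edist x y < c) :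
    ∃ j : Set.Icc (0 : ℝ) T ≃o Set.Icc (0 : ℝ) T, (∀ t, edist t (j t) < c) ∧
      ∀ t, edist (x.toFun t) (y.toFun (j t)) < c := by
  obtain ⟨j, hj⟩ := iInf_lt_iff.1 h
  exact ⟨j, fun t => ((le_iSup (fun t => edist t (j t)) t).trans le_sup_left).trans_lt hj,
    fun t => ((le_iSup (fun t => edist (x.toFun t) (y.toFun (j t))) t).trans le_sup_right).trans_lt
      hj⟩

/-- Convergence in the Skorokhod topology implies convergence at the points of continuity of the
limit. -/
lemma tendsto_apply_of_continuousAt {ι : Type*} {l : Filter ι} {x : ι → SkorokhodSpace T H}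
    {y : SkorokhodSpace T H} (h : Tendsto x l (𝓝 y)) {s : Set.Icc (0 : ℝ) T}
    (hs : ContinuousAt y.toFun s) : Tendsto (fun a => (x a).toFun s) l (𝓝 (y.toFun s)) := by
  rw [EMetric.tendsto_nhds] at h ⊢
  intro ε hε
  have hε2 : 0 < ε / 2 := ENNReal.half_pos hε.ne'
  obtain ⟨δ, hδ, hsδ⟩ := EMetric.continuousAt_iff.1 hs (ε / 2) hε2
  filter_upwards [h _ (lt_min hδ hε2)] with a ha
  obtain ⟨j, hj, hj'⟩ := exists_timeChange_of_edist_lt ha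
  calc edist ((x a).toFun s) (y.toFun s)
      ≤ edist ((x a).toFun s) (y.toFun (j s)) + edist (y.toFun (j s)) (y.toFun s) :=
        edist_triangle _ _ _
    _ < ε / 2 + ε / 2 := ENNReal.add_lt_add ((hj' s).trans_le (min_le_right _ _))
        (hsδ (by rw [edist_comm]; exact (hj s).trans_le (min_le_left _ _)))
    _ = ε := ENNReal.add_halves ε

/-- Every time change fixes the final time, so continuity of the limit is not needed there. -/
lemma tendsto_apply_of_isTop {ι : Type*} {l : Filter ι} {x : ι → SkorokhodSpace T H}
    {y : SkorokhodSpace T H} (h : Tendsto x l (𝓝 y)) {s : Set.Icc (0 : ℝ) T}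
    (hs : IsTop s) : Tendsto (fun a => (x a).toFun s) l (𝓝 (y.toFun s)) := by
  rw [EMetric.tendsto_nhds] at h ⊢
  intro ε hε
  filter_upwards [h ε hε] with a ha
  obtain ⟨j, -, hj'⟩ := exists_timeChange_of_edist_lt ha
  have hjs : j s = s :=
    le_antisymm (hs _) (by simpa using j.monotone (hs (j.symm s)))
  simpa [hjs] using hj' s

/-- Uniform bounds between càdlàg functions pass to Skorokhod limits that have points of
continuity arbitrarily close on the right of every time. -/
lemma edist_apply_le_of_tendsto {ι : Type*} {l : Filter ι} [l.NeBot]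
    {x x' : ι → SkorokhodSpace T H} {y y' : SkorokhodSpace T H}
    (h : Tendsto x l (𝓝 y)) (h' : Tendsto x' l (𝓝 y'))
    (hy : ∀ s, ∀ᶠ s' in 𝓝[>] s, ContinuousAt y.toFun s')
    (hy' : ∀ s, ∀ᶠ s' in 𝓝[>] s, ContinuousAt y'.toFun s') {c : ℝ≥0∞}
    (hc : ∀ᶠ a in l, ∀ s, edist ((x a).toFun s) ((x' a).toFun s) ≤ c) (s : Set.Icc (0 : ℝ) T) :
    edist (y.toFun s) (y'.toFun s) ≤ c := by
  by_cases hs : IsTop s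
  · exact le_of_tendsto ((tendsto_apply_of_isTop h hs).edist (tendsto_apply_of_isTop h' hs))
      (hc.mono fun a ha => ha s)
  · have hsT : s < ⟨T, s.2.1.trans s.2.2, le_rfl⟩ := by
      obtain ⟨b, hb⟩ := not_forall.1 hs
      exact (not_le.1 hb).trans_le b.2.2
    have : (𝓝[>] s).NeBot := nhdsGT_neBot_of_exists_gt ⟨_, hsT⟩
    have key : ∀ᶠ s' in 𝓝[>] s, edist (y.toFun s') (y'.toFun s') ≤ c := by
      filter_upwards [hy s, hy' s] with s' h1 h2
      exact le_of_tendsto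
        ((tendsto_apply_of_continuousAt h h1).edist (tendsto_apply_of_continuousAt h' h2))
        (hc.mono fun a ha => ha s')
    exact le_of_tendsto
      ((((y.cadlag.1 s).mono Set.Ioi_subset_Ici_self).tendsto).edist
        (((y'.cadlag.1 s).mono Set.Ioi_subset_Ici_self).tendsto)) key

/-- A uniform limit of càdlàg functions is càdlàg. -/
lemma _root_.IsCadlagOn.of_forall_edist_lt [CompleteSpace H] {x : Set.Icc (0 : ℝ) T → H}
    (h : ∀ ε : ℝ≥0∞, 0 < ε → ∃ y : Set.Icc (0 : ℝ) T → H, IsCadlagOn y ∧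
      ∀ s, edist (x s) (y s) < ε) : IsCadlagOn x := by
  have three : ∀ (ε : ℝ≥0∞) (y : Set.Icc (0 : ℝ) T → H), (∀ s, edist (x s) (y s) < ε / 3) →
      ∀ a b, edist (y a) (y b) < ε / 3 → edist (x a) (x b) < ε := by
    intro ε y hy a b hab
    calc edist (x a) (x b) ≤ edist (x a) (y a) + edist (y a) (y b) + edist (y b) (x b) :=
          edist_triangle4 _ _ _ _
      _ < ε / 3 + ε / 3 + ε / 3 :=
          ENNReal.add_lt_add (ENNReal.add_lt_add (hy a) hab) (by rw [edist_comm]; exact hy b)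
      _ = ε := ENNReal.add_thirds ε
  refine ⟨fun s => EMetric.tendsto_nhds.2 fun ε hε => ?_, fun s => ?_⟩
  · have hε3 : 0 < ε / 3 := ENNReal.div_pos hε.ne' (by norm_num)
    obtain ⟨y, hy, hxy⟩ := h _ hε3
    filter_upwards [EMetric.tendsto_nhds.1 (hy.1 s) _ hε3] with a ha
    exact three ε y hxy a s ha
  -- At the left endpoint the filter is trivial and any value serves as left limit.
  · rcases (𝓝[<] s).eq_or_neBot with hb | hb
    · exact ⟨x s, by simp [hb]⟩
    refine cauchy_map_iff_exists_tendsto.1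
      (EMetric.cauchy_iff.2 ⟨(map_neBot_iff x).2 hb |>.ne, fun ε hε => ?_⟩)
    obtain ⟨y, hy, hxy⟩ := h _ (ENNReal.div_pos hε.ne' (by norm_num : (3 : ℝ≥0∞) ≠ ⊤))
    have hc := cauchy_map_iff_exists_tendsto.2 (hy.2 s)
    obtain ⟨A, hA, hA'⟩ := (EMetric.cauchy_iff.1 hc).2 _
      (ENNReal.div_pos hε.ne' (by norm_num : (3 : ℝ≥0∞) ≠ ⊤))
    refine ⟨x '' (y ⁻¹' A), image_mem_map hA, ?_⟩
    rintro _ ⟨a, ha, rfl⟩ _ ⟨b, hb, rfl⟩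
    exact three ε y hxy a b (hA' _ ha _ hb)

/-- The functions that are, for each `k`, within uniform distance `c k` of a compact set `S k` of
step-like functions form a compact set if `c k` tends to `0`. -/
theorem isCompact_setOf_forall_exists_edist_le [CompleteSpace H] {S : ℕ → Set (SkorokhodSpace T H)}
    (hS : ∀ k, IsCompact (S k))
    (hcont : ∀ k, ∀ y ∈ S k, ∀ s, ∀ᶠ s' in 𝓝[>] s, ContinuousAt y.toFun s')
    {c : ℕ → ℝ≥0∞} (hc : Tendsto c atTop (𝓝 0)) :
    IsCompact {x : SkorokhodSpace T H |
      ∀ k, ∃ y ∈ S k, ∀ s, edist (x.toFun s) (y.toFun s) ≤ c k} := by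
  set K := {x : SkorokhodSpace T H | ∀ k, ∃ y ∈ S k, ∀ s, edist (x.toFun s) (y.toFun s) ≤ c k}
    with hK
  refine isCompact_iff_ultrafilter_le_nhds.2 fun 𝒰 h𝒰 => ?_
  have h𝒰 : K ∈ 𝒰 := le_principal_iff.1 h𝒰
  obtain ⟨x₀, hx₀⟩ := 𝒰.nonempty_of_mem h𝒰
  -- Pushing the ultrafilter forward requires an approximant for every `x`; off `K` any point of `S
  -- k` serves, and there is one because `K` is nonempty.
  have hex : ∀ x k, ∃ y ∈ S k, x ∈ K → ∀ s, edist (x.toFun s) (y.toFun s) ≤ c k := by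
    intro x k
    by_cases hx : x ∈ K
    · obtain ⟨y, hy, h⟩ := hx k
      exact ⟨y, hy, fun _ => h⟩
    · obtain ⟨y, hy, -⟩ := hx₀ k
      exact ⟨y, hy, fun h => absurd h hx⟩
  choose Y hYS hY using hex
  have hlim : ∀ k, ∃ y ∈ S k, Tendsto (fun x => Y x k) 𝒰 (𝓝 y) := by
    intro k
    obtain ⟨y, hy, hle⟩ := isCompact_iff_ultrafilter_le_nhds.1 (hS k) (𝒰.map fun x => Y x k)
      (le_principal_iff.2 (mem_map.2 (univ_mem' fun x => hYS x k)))
    exact ⟨y, hy, hle⟩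
  choose y hyS hy using hlim
  -- On `K` the two approximants of one function are within `c k + c l` of each other, and this
  -- uniform bound passes to their limits.
  have hyy : ∀ k l s, edist ((y k).toFun s) ((y l).toFun s) ≤ c k + c l := by
    intro k l s
    refine edist_apply_le_of_tendsto (hy k) (hy l) (hcont k _ (hyS k)) (hcont l _ (hyS l)) ?_ s
    filter_upwards [h𝒰] with x hx s
    exact (edist_triangle_left _ _ (x.toFun s)).trans (add_le_add (hY x k hx s) (hY x l hx s))
  have hcauchy : ∀ s, CauchySeq fun k => (y k).toFun s := by
    intro s
    refine EMetric.cauchySeq_iff.2 fun ε hε => ?_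
    obtain ⟨n, hn⟩ := eventually_atTop.1 (hc.eventually_lt_const (ENNReal.half_pos hε.ne'))
    exact ⟨n, fun k hk l hl => (hyy k l s).trans_lt
      ((ENNReal.add_lt_add (hn k hk) (hn l hl)).trans_eq (ENNReal.add_halves ε))⟩
  choose z hz using fun s => cauchySeq_tendsto_of_complete (hcauchy s)
  have hzy : ∀ k s, edist (z s) ((y k).toFun s) ≤ c k := by
    intro k s
    refine le_of_tendsto_of_tendsto' ((hz s).edist tendsto_const_nhds)
      (by simpa using hc.add_const (c k)) fun l => hyy l k s
  let Z : SkorokhodSpace T H := ⟨z, IsCadlagOn.of_forall_edist_lt fun ε hε => by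
    obtain ⟨k, hk⟩ := (hc.eventually_lt_const hε).exists
    exact ⟨_, (y k).cadlag, fun s => (hzy k s).trans_lt hk⟩⟩
  refine ⟨Z, fun k => ⟨y k, hyS k, hzy k⟩, ?_⟩
  have : Tendsto id (𝒰 : Filter (SkorokhodSpace T H)) (𝓝 Z) := by
    refine EMetric.tendsto_nhds.2 fun ε hε => ?_
    have hε3 : 0 < ε / 3 := ENNReal.div_pos hε.ne' (by norm_num)
    obtain ⟨k, hk⟩ := (hc.eventually_lt_const hε3).exists
    filter_upwards [h𝒰, EMetric.tendsto_nhds.1 (hy k) _ hε3] with x hx hxk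
    calc edist x Z ≤ edist x (Y x k) + edist (Y x k) (y k) + edist (y k) Z :=
          edist_triangle4 _ _ _ _
      _ < ε / 3 + ε / 3 + ε / 3 :=
          ENNReal.add_lt_add (ENNReal.add_lt_add
            ((edist_le_of_forall (hY x k hx)).trans_lt hk) hxk)
            (by rw [edist_comm]; exact (edist_le_of_forall (hzy k)).trans_lt hk)
      _ = ε := ENNReal.add_thirds ε
  exact this

/-! ### Compact families of step functions -/

lemma edist_step_le_of_values (N : ℕ) (t : ℕ → Set.Icc (0 : ℝ) T) {v w : ℕ → H} {c : ℝ≥0∞}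
    (h : ∀ i ≤ N, edist (v i) (w i) ≤ c) : edist (step N t v) (step N t w) ≤ c :=
  edist_le_of_forall fun _ => h _ (countLE_le _)

/-- The time change that matches the jumps makes the values agree exactly, so only its displacement
is paid. -/
lemma edist_step_le_of_times {N : ℕ} {t u : ℕ → Set.Icc (0 : ℝ) T}
    (ht0 : (t 0 : ℝ) = 0) (hu0 : (u 0 : ℝ) = 0) (htN : (t N : ℝ) = T) (huN : (u N : ℝ) = T)
    (ht : ∀ i < N, t i < t (i + 1)) (hu : ∀ i < N, u i < u (i + 1)) {r : ℝ}
    (hr : ∀ i ≤ N, |(u i : ℝ) - t i| ≤ r) (v : ℕ → H) :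
    edist (step N t v) (step N u v) ≤ ENNReal.ofReal (2 * N * r) := by
  obtain ⟨j, hj, hjr⟩ := exists_timeChange ht0 hu0 htN huN ht hu hr
  refine edist_le_of_timeChange j (fun s => ?_) (fun s => ?_)
  · rw [edist_comm, Subtype.edist_eq, edist_dist, Real.dist_eq]
    exact ENNReal.ofReal_le_ofReal (hjr s)
  · have : countLE N t s = countLE N u (j s) := countLE_congr fun i hi => by
      rw [← hj (i + 1) hi, j.le_iff_le]
    simp [step, this]

end SkorokhodSpace

lemma add_mul_le_of_forall_add_le {t : ℕ → ℝ} {N : ℕ} {δ : ℝ}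
    (h : ∀ i < N, t i + δ ≤ t (i + 1)) : t 0 + N * δ ≤ t N := by
  induction N with
  | zero => simp
  | succ N ih =>
    have h1 := ih fun i hi => h i (hi.trans (Nat.lt_succ_self N))
    have h2 := h N (Nat.lt_succ_self N)
    push_cast
    linarith

namespace SkorokhodSpace

variable {T : ℝ} {H : Type*}

/-- The step functions with jumps at least `δ` apart and with values in `C`. -/
def stepsIn [TopologicalSpace H] (δ : ℝ) (C : Set H) : Set (SkorokhodSpace T H) :=
  {x | ∃ (N : ℕ) (t : ℕ → Set.Icc (0 : ℝ) T) (v : ℕ → H), (t 0 : ℝ) = 0 ∧ (t N : ℝ) = T ∧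
    (∀ i < N, (t i : ℝ) + δ ≤ t (i + 1)) ∧ (∀ i, v i ∈ C) ∧ step N t v = x}

variable [PseudoEMetricSpace H]

/-- The neighbourhood does not depend on the partition; this uniformity gives joint continuity in
times and values. -/
lemma eventually_edist_step_values_le (N : ℕ) (v : ℕ → H) {ε : ℝ≥0∞} (hε : 0 < ε) :
    ∀ᶠ w in 𝓝 v, ∀ t : ℕ → Set.Icc (0 : ℝ) T, edist (step N t w) (step N t v) ≤ ε := by
  have : ∀ i ∈ Finset.range (N + 1), ∀ᶠ w : ℕ → H in 𝓝 v, edist (w i) (v i) < ε := fun i _ =>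
    EMetric.tendsto_nhds.1 ((continuous_apply i).tendsto v) _ hε
  filter_upwards [(Finset.eventually_all _).2 this] with w hw t
  exact edist_step_le_of_values N t fun i hi => (hw i (Finset.mem_range_succ_iff.2 hi)).le

lemma continuous_step (N : ℕ) (t : ℕ → Set.Icc (0 : ℝ) T) :
    Continuous (step N t : (ℕ → H) → SkorokhodSpace T H) :=
  continuous_iff_continuousAt.2 fun v => Metric.nhds_basis_closedEBall.tendsto_right_iff.2
    fun _ hε => (eventually_edist_step_values_le N v hε).mono fun _ hw => hw t

/-- For each `N`, the admissible partitions form a closed subset of a compact product, and the step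
function depends jointly continuously on times and values there. Gaps of at least `δ` force `N ≤ T /
δ`, leaving finitely many `N`. -/
lemma isCompact_stepsIn {δ : ℝ} (hδ : 0 < δ) {C : Set H} (hC : IsCompact C) :
    IsCompact (stepsIn δ C : Set (SkorokhodSpace T H)) := by
  let B : ℕ → Set (ℕ → Set.Icc (0 : ℝ) T) := fun N =>
    {t | (t 0 : ℝ) = 0 ∧ (t N : ℝ) = T ∧ ∀ i < N, (t i : ℝ) + δ ≤ t (i + 1)}
  have hB : ∀ N, IsCompact (B N) := fun N => by
    refine IsClosed.isCompact ?_
    have hcoe : ∀ i, Continuous fun t : ℕ → Set.Icc (0 : ℝ) T => (t i : ℝ) := fun i =>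
      continuous_subtype_val.comp (continuous_apply i)
    have h3 : IsClosed (⋂ i, ⋂ _ : i < N,
        {t : ℕ → Set.Icc (0 : ℝ) T | (t i : ℝ) + δ ≤ t (i + 1)}) :=
      isClosed_iInter fun i => isClosed_iInter fun _ =>
        isClosed_le ((hcoe i).add continuous_const) (hcoe (i + 1))
    convert (isClosed_eq (hcoe 0) (continuous_const (y := (0 : ℝ)))).inter
      ((isClosed_eq (hcoe N) (continuous_const (y := T))).inter h3) using 1
    ext t
    simp [B]
  have hlt : ∀ N, ∀ t ∈ B N, ∀ i < N, t i < t (i + 1) := fun N t ht i hi =>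
    show (t i : ℝ) < t (i + 1) by linarith [ht.2.2 i hi]
  have hcont : ∀ N, ContinuousOn
      (fun p : (ℕ → Set.Icc (0 : ℝ) T) × (ℕ → H) => (step N p.1 p.2 : SkorokhodSpace T H))
      (B N ×ˢ Set.univ.pi fun _ => C) := by
    rintro N ⟨t, v⟩ ⟨ht, -⟩
    refine Metric.nhds_basis_closedEBall.tendsto_right_iff.2 fun ε hε => ?_
    obtain ⟨ρ, hρ, hρε⟩ : ∃ ρ : ℝ, 0 < ρ ∧ ENNReal.ofReal (2 * N * ρ) ≤ ε / 2 := by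
      have hlim : Tendsto (fun ρ : ℝ => ENNReal.ofReal (2 * N * ρ)) (𝓝[>] 0) (𝓝 0) := by
        have : Continuous fun ρ : ℝ => ENNReal.ofReal (2 * N * ρ) :=
          ENNReal.continuous_ofReal.comp (by fun_prop)
        simpa using (this.tendsto 0).mono_left nhdsWithin_le_nhds
      obtain ⟨ρ, h1, h2⟩ := ((hlim.eventually_lt_const (ENNReal.half_pos hε.ne')).and
        self_mem_nhdsWithin).exists
      exact ⟨ρ, h2, h1.le⟩
    have h1 : ∀ᶠ p : (ℕ → Set.Icc (0 : ℝ) T) × (ℕ → H) in 𝓝 (t, v),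
        ∀ s : ℕ → Set.Icc (0 : ℝ) T, edist (step N s p.2) (step N s v) ≤ ε / 2 :=
      continuous_snd.tendsto (t, v)
        |>.eventually (eventually_edist_step_values_le N v (ENNReal.half_pos hε.ne'))
    have h2 : ∀ i ∈ Finset.range (N + 1), ∀ᶠ p : (ℕ → Set.Icc (0 : ℝ) T) × (ℕ → H) in 𝓝 (t, v),
        |(t i : ℝ) - p.1 i| < ρ := fun i _ => by
      have hc : Continuous fun p : (ℕ → Set.Icc (0 : ℝ) T) × (ℕ → H) => |(t i : ℝ) - p.1 i| := by
        have : Continuous fun p : (ℕ → Set.Icc (0 : ℝ) T) × (ℕ → H) => (p.1 i : ℝ) :=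
          continuous_subtype_val.comp ((continuous_apply i).comp continuous_fst)
        fun_prop
      have := hc.tendsto (t, v)
      simp only [sub_self, abs_zero] at this
      exact this.eventually_lt_const hρ
    filter_upwards [mem_nhdsWithin_of_mem_nhds h1,
      mem_nhdsWithin_of_mem_nhds ((Finset.eventually_all _).2 h2), self_mem_nhdsWithin]
      with p hp1 hp2 hp3
    refine (edist_triangle _ (step N p.1 v) _).trans ((add_le_add (hp1 p.1) ?_).trans_eq
      (ENNReal.add_halves ε))
    exact (edist_step_le_of_times hp3.1.1 ht.1 hp3.1.2.1 ht.2.1 (hlt N _ hp3.1) (hlt N _ ht)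
      (fun i hi => (hp2 i (Finset.mem_range_succ_iff.2 hi)).le) v).trans hρε
  have heq : (stepsIn δ C : Set (SkorokhodSpace T H)) = ⋃ N ∈ Finset.range (⌊T / δ⌋₊ + 1),
      (fun p : (ℕ → Set.Icc (0 : ℝ) T) × (ℕ → H) => (step N p.1 p.2 : SkorokhodSpace T H)) ''
        (B N ×ˢ Set.univ.pi fun _ => C) := by
    ext x
    simp only [Set.mem_iUnion, Finset.mem_range_succ_iff]
    constructor
    · rintro ⟨N, t, v, h0, hN, hd, hv, rfl⟩
      refine ⟨N, Nat.le_floor ?_, (t, v), ⟨⟨h0, hN, hd⟩, fun i _ => hv i⟩, rfl⟩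
      have := add_mul_le_of_forall_add_le (t := fun i => (t i : ℝ)) hd
      rw [le_div_iff₀ hδ]
      simpa [h0, hN] using this
    · rintro ⟨N, -, ⟨t, v⟩, ⟨⟨h0, hN, hd⟩, hv⟩, rfl⟩
      exact ⟨N, t, v, h0, hN, hd, fun i => hv i trivial, rfl⟩
  rw [heq]
  exact (Finset.range _).isCompact_biUnion fun N _ =>
    ((hB N).prod (isCompact_univ_pi fun _ => hC)).image_of_continuousOn (hcont N)

/-- A set of functions that can be approximated uniformly by step functions with gaps bounded
below and values in a compact set, at every precision, is contained in a compact set. -/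
theorem isCompact_setOf_forall_exists_stepsIn [CompleteSpace H] {δ : ℕ → ℝ} (hδ : ∀ k, 0 < δ k)
    {C : ℕ → Set H} (hC : ∀ k, IsCompact (C k)) {c : ℕ → ℝ≥0∞} (hc : Tendsto c atTop (𝓝 0)) :
    IsCompact {x : SkorokhodSpace T H |
      ∀ k, ∃ y ∈ stepsIn (δ k) (C k), ∀ s, edist (x.toFun s) (y.toFun s) ≤ c k} := by
  refine isCompact_setOf_forall_exists_edist_le (fun k => isCompact_stepsIn (hδ k) (hC k)) ?_ hc
  rintro k _ ⟨N, t, v, -, -, -, -, rfl⟩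
  exact eventually_continuousAt_step N t v

end SkorokhodSpace

/-! ### Partitions of càdlàg paths and sampling on grids -/

lemma exists_sequence_of_reflTransGen {α : Type*} {R : α → α → Prop} {a b : α}
    (h : Relation.ReflTransGen R a b) :
    ∃ (N : ℕ) (t : ℕ → α), t 0 = a ∧ t N = b ∧ ∀ i < N, R (t i) (t (i + 1)) := by
  induction h with
  | refl => exact ⟨0, fun _ => a, rfl, rfl, fun i hi => absurd hi (Nat.not_lt_zero i)⟩
  | @tail b c _ hbc ih =>
    obtain ⟨N, t, h0, hN, hR⟩ := ih
    refine ⟨N + 1, fun i => if i ≤ N then t i else c, by simp [h0], by simp, fun i hi => ?_⟩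
    rcases (Nat.lt_succ_iff.1 hi).lt_or_eq with hi | rfl
    · simpa [hi.le, Nat.succ_le_of_lt hi] using hR i hi
    · simpa [hN] using hbc

/-- A càdlàg function has a partition on whose half-open intervals it oscillates by at most
`ε`. -/
lemma IsCadlagOn.exists_partition {T : ℝ} (hT : 0 ≤ T) {H : Type*} [PseudoEMetricSpace H]
    {x : Set.Icc (0 : ℝ) T → H} (hx : IsCadlagOn x) {ε : ℝ≥0∞} (hε : 0 < ε) :
    ∃ (N : ℕ) (t : ℕ → Set.Icc (0 : ℝ) T), (t 0 : ℝ) = 0 ∧ (t N : ℝ) = T ∧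
      ∀ i < N, t i < t (i + 1) ∧ ∀ s ∈ Set.Ico (t i) (t (i + 1)),
        ∀ s' ∈ Set.Ico (t i) (t (i + 1)), edist (x s) (x s') ≤ ε := by
  -- Partitions are chains for `R`. Near `c`, an interval is split at `c` into a piece controlled by
  -- the left limit and one controlled by right continuity; compactness of `[0,T]` joins the local
  -- chains.
  let R : Set.Icc (0 : ℝ) T → Set.Icc (0 : ℝ) T → Prop := fun a b =>
    a < b ∧ ∀ s ∈ Set.Ico a b, ∀ s' ∈ Set.Ico a b, edist (x s) (x s') ≤ ε
  have close : ∀ (l : H) (s s'), edist (x s) l < ε / 2 → edist (x s') l < ε / 2 →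
      edist (x s) (x s') ≤ ε := fun l s s' h h' =>
    (edist_triangle_right _ _ l).trans ((add_le_add h.le h'.le).trans_eq (ENNReal.add_halves ε))
  have hloc : ∀ c : Set.Icc (0 : ℝ) T, ∃ U : Set (Set.Icc (0 : ℝ) T), IsOpen U ∧ c ∈ U ∧
      ∀ a b, a ≤ b → Set.Icc a b ⊆ U → Relation.ReflTransGen R a b := by
    intro c
    obtain ⟨l, hl⟩ := hx.2 c
    obtain ⟨U, hUo, hcU, hU⟩ := mem_nhdsWithin.1
      (EMetric.tendsto_nhds.1 (hx.1 c) _ (ENNReal.half_pos hε.ne'))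
    obtain ⟨V, hVo, hcV, hV⟩ := mem_nhdsWithin.1
      (EMetric.tendsto_nhds.1 hl _ (ENNReal.half_pos hε.ne'))
    have right : ∀ a b, c ≤ a → a < b → Set.Icc a b ⊆ U → R a b := fun a b hca hab hs =>
      ⟨hab, fun s h s' h' => close _ s s' (hU ⟨hs ⟨h.1, h.2.le⟩, hca.trans h.1⟩)
        (hU ⟨hs ⟨h'.1, h'.2.le⟩, hca.trans h'.1⟩)⟩
    have left : ∀ a b, b ≤ c → a < b → Set.Icc a b ⊆ V → R a b := fun a b hbc hab hs =>
      ⟨hab, fun s h s' h' => close _ s s' (hV ⟨hs ⟨h.1, h.2.le⟩, h.2.trans_le hbc⟩)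
        (hV ⟨hs ⟨h'.1, h'.2.le⟩, h'.2.trans_le hbc⟩)⟩
    refine ⟨U ∩ V, hUo.inter hVo, ⟨hcU, hcV⟩, fun a b hab hs => ?_⟩
    rcases hab.eq_or_lt with rfl | hab
    · exact .refl
    rcases le_or_gt b c with hbc | hcb
    · exact .single (left a b hbc hab fun s h => (hs h).2)
    rcases le_or_gt c a with hca | hac
    · exact .single (right a b hca hab fun s h => (hs h).1)
    · exact .tail (.single (left a c le_rfl hac fun s h => (hs ⟨h.1, h.2.trans hcb.le⟩).2))
        (right c b le_rfl hcb fun s h => (hs ⟨hac.le.trans h.1, h.2⟩).1)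
  choose U hUo hcU hU using hloc
  obtain ⟨t, ht0, htm, ⟨n, hn⟩, htU⟩ := exists_monotone_Icc_subset_open_cover_Icc hT hUo
    fun c _ => Set.mem_iUnion.2 ⟨c, hcU c⟩
  have hchain : ∀ m, Relation.ReflTransGen R (t 0) (t m) := by
    intro m
    induction m with
    | zero => exact .refl
    | succ m ih =>
      obtain ⟨c, hc⟩ := htU m
      exact ih.trans (hU c _ _ (htm m.le_succ) hc)
  obtain ⟨N, u, hu0, huN, hu⟩ := exists_sequence_of_reflTransGen (hchain n)
  exact ⟨N, u, by rw [hu0, ht0], by rw [huN, hn n le_rfl], hu⟩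

/-- The point `p T / M ∧ T` of `[0,T]`. -/
noncomputable def gridPoint {T : ℝ} (hT : 0 ≤ T) (M p : ℕ) : Set.Icc (0 : ℝ) T :=
  Set.projIcc 0 T hT (p * (T / M))

section gridPoint

variable {T : ℝ} (hT : 0 ≤ T) {M : ℕ}

lemma gridPoint_mono : Monotone (gridPoint hT M) := fun p q h =>
  Set.monotone_projIcc hT (mul_le_mul_of_nonneg_right (Nat.cast_le.2 h) (by positivity))

lemma coe_gridPoint (hM : 0 < M) {p : ℕ} (hp : p ≤ M) :
    (gridPoint hT M p : ℝ) = p * (T / M) := by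
  have hM' : (0 : ℝ) < M := Nat.cast_pos.2 hM
  have : (p : ℝ) * (T / M) ≤ M * (T / M) :=
    mul_le_mul_of_nonneg_right (Nat.cast_le.2 hp) (by positivity)
  rw [mul_div_cancel₀ T hM'.ne'] at this
  rw [gridPoint, Set.projIcc_of_mem hT ⟨by positivity, this⟩]

lemma coe_gridPoint_zero : (gridPoint hT M 0 : ℝ) = 0 := by
  simp [gridPoint, Set.projIcc, hT]

lemma coe_gridPoint_of_le (hM : 0 < M) {p : ℕ} (hp : M ≤ p) : (gridPoint hT M p : ℝ) = T := by
  refine le_antisymm (gridPoint hT M p).2.2 ?_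
  have h : (gridPoint hT M M : ℝ) ≤ gridPoint hT M p := gridPoint_mono hT hp
  rwa [coe_gridPoint hT hM le_rfl, mul_div_cancel₀ T (Nat.cast_pos.2 hM).ne'] at h

lemma gridPoint_lt (hT : 0 < T) (hM : 0 < M) {p q : ℕ} (hpq : p < q) (hp : p < M) :
    gridPoint hT.le M p < gridPoint hT.le M q := by
  have h1 : gridPoint hT.le M p < gridPoint hT.le M (p + 1) := by
    rw [← Subtype.coe_lt_coe, coe_gridPoint hT.le hM hp.le, coe_gridPoint hT.le hM hp]
    have : (0 : ℝ) < T / M := div_pos hT (Nat.cast_pos.2 hM)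
    push_cast
    linarith
  exact h1.trans_le (gridPoint_mono hT.le hpq)

end gridPoint

namespace SkorokhodSpace

variable {T : ℝ} {H : Type*}

/-- The step function that agrees with `x` at the points of the grid of mesh `T / M`. -/
noncomputable def sample [TopologicalSpace H] (hT : 0 ≤ T) (M : ℕ) (x : Set.Icc (0 : ℝ) T → H) :
    SkorokhodSpace T H :=
  step M (gridPoint hT M) fun p => x (gridPoint hT M p)

lemma sample_apply [TopologicalSpace H] (hT : 0 < T) {M : ℕ} (hM : 0 < M)
    (x : Set.Icc (0 : ℝ) T → H) (s : Set.Icc (0 : ℝ) T) :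
    ∃ p ≤ M, (sample hT.le M x).toFun s = x (gridPoint hT.le M p) ∧ gridPoint hT.le M p ≤ s ∧
      (p < M → s < gridPoint hT.le M (p + 1)) := by
  have hlt : ∀ i < M, gridPoint hT.le M i < gridPoint hT.le M (i + 1) := fun i hi =>
    gridPoint_lt hT hM i.lt_succ_self hi
  rcases lt_or_ge s (gridPoint hT.le M M) with h | h
  · obtain ⟨p, hp, h1, h2⟩ := exists_between_consecutive
      (show gridPoint hT.le M 0 ≤ s by
        rw [← Subtype.coe_le_coe, coe_gridPoint_zero]; exact s.2.1) h
    exact ⟨p, hp.le, by simp only [sample, step, countLE_eq hlt hp h1 h2], h1, fun _ => h2⟩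
  · exact ⟨M, le_rfl, by simp only [sample, step, countLE_eq_last hlt h], h,
      fun h => absurd h (lt_irrefl M)⟩

/-- The samples of a càdlàg function on finer and finer grids converge to it. -/
theorem tendsto_sample [PseudoEMetricSpace H] (hT : 0 < T) (x : SkorokhodSpace T H) :
    Tendsto (fun M : ℕ => sample hT.le (M + 1) x.toFun) atTop (𝓝 x) := by
  refine Metric.nhds_basis_closedEBall.tendsto_right_iff.2 fun ε hε => ?_
  obtain ⟨N, t, ht0, htN, ht⟩ := x.cadlag.exists_partition hT.le hε
  obtain ⟨g, hg, hgt⟩ : ∃ g : ℝ, 0 < g ∧ ∀ i < N, (t i : ℝ) + g ≤ t (i + 1) := by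
    have : ∀ i ∈ Finset.range N, ∀ᶠ g : ℝ in 𝓝[>] 0, (t i : ℝ) + g ≤ t (i + 1) := by
      intro i hi
      have h : (0 : ℝ) < t (i + 1) - t i := sub_pos.2 (ht i (Finset.mem_range.1 hi)).1
      filter_upwards [mem_nhdsWithin_of_mem_nhds (Iio_mem_nhds h)] with g hg
      linarith [Set.mem_Iio.1 hg]
    obtain ⟨g, h1, h2⟩ := (((Finset.eventually_all _).2 this).and self_mem_nhdsWithin).exists
    exact ⟨g, h2, fun i hi => h1 i (Finset.mem_range.2 hi)⟩
  have hmesh : Tendsto (fun M : ℕ => T / ((M + 1 : ℕ) : ℝ)) atTop (𝓝 0) :=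
    (tendsto_const_div_atTop_nhds_zero_nat T).comp (tendsto_add_atTop_nat 1)
  have hmesh' : Tendsto (fun M : ℕ => ENNReal.ofReal (2 * N * (T / ((M + 1 : ℕ) : ℝ)))) atTop
      (𝓝 0) := by
    simpa using ENNReal.tendsto_ofReal (hmesh.const_mul (2 * N : ℝ))
  filter_upwards [hmesh.eventually_lt_const hg, hmesh'.eventually_lt_const hε] with M hM1 hM2
  have hM : 0 < M + 1 := M.succ_pos
  set m := M + 1
  set h := T / (m : ℝ) with hh
  have hmpos : (0 : ℝ) < m := Nat.cast_pos.2 hM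
  have hpos : 0 < h := div_pos hT hmpos
  -- Partition points are rounded up to the grid, and a mesh below `g` keeps them ordered. A time
  -- between `u i` and `u (i + 1)` is then sampled at a grid point in `[t i, t (i + 1))`, where the
  -- time change also sends it.
  let k : ℕ → ℕ := fun i => ⌈(t i : ℝ) / h⌉₊
  have hkm : ∀ i, k i ≤ m := fun i => Nat.ceil_le.2 (by
    rw [div_le_iff₀ hpos, hh, mul_div_cancel₀ T hmpos.ne']
    exact (t i).2.2)
  let u : ℕ → Set.Icc (0 : ℝ) T := fun i => gridPoint hT.le m (k i)
  have hu : ∀ i, (u i : ℝ) = k i * h := fun i => coe_gridPoint hT.le hM (hkm i)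
  have hu1 : ∀ i, (t i : ℝ) ≤ u i := fun i => by
    rw [hu, ← div_le_iff₀ hpos]
    exact Nat.le_ceil _
  have hu2 : ∀ i, (u i : ℝ) < t i + h := fun i => by
    have := Nat.ceil_lt_add_one (div_nonneg (t i).2.1 hpos.le)
    rw [hu]
    calc (k i : ℝ) * h < (t i / h + 1) * h := mul_lt_mul_of_pos_right this hpos
      _ = t i + h := by field_simp
  have hu0 : (u 0 : ℝ) = 0 := by simp [hu, k, ht0]
  have huN : (u N : ℝ) = T := le_antisymm (u N).2.2 (htN.symm.trans_le (hu1 N))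
  have hut : ∀ i < N, u i < u (i + 1) := fun i hi =>
    show (u i : ℝ) < u (i + 1) by linarith [hu2 i, hgt i hi, hu1 (i + 1)]
  obtain ⟨j, hj, hjr⟩ := exists_timeChange hu0 ht0 huN htN hut (fun i hi => (ht i hi).1)
    (r := h) (fun i _ => by rw [abs_sub_comm, abs_le]; constructor <;> linarith [hu1 i, hu2 i])
  refine edist_le_of_timeChange j (fun s => ?_) (fun s => ?_)
  · rw [edist_comm, Subtype.edist_eq, edist_dist, Real.dist_eq]
    exact (ENNReal.ofReal_le_ofReal (hjr s)).trans hM2.le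
  · obtain ⟨p, hpm, hps, hp1, hp2⟩ := sample_apply hT hM x.toFun s
    rw [hps]
    rcases lt_or_ge s (u N) with hsN | hsN
    · have hpm : p < m := by
        refine hpm.lt_of_ne fun hpm => ?_
        have : (gridPoint hT.le m p : ℝ) ≤ s := hp1
        rw [coe_gridPoint_of_le hT.le hM hpm.ge] at this
        exact absurd hsN (not_lt.2 (huN.trans_le this))
      obtain ⟨i, hi, h1, h2⟩ := exists_between_consecutive
        (show u 0 ≤ s from hu0.trans_le s.2.1) hsN
      have hpi : p < k (i + 1) := (gridPoint_mono hT.le).reflect_lt (hp1.trans_lt h2)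
      have hip : k i ≤ p := Nat.lt_succ_iff.1
        ((gridPoint_mono hT.le).reflect_lt (h1.trans_lt (hp2 hpm)))
      refine (ht i hi).2 _ ⟨?_, ?_⟩ _ ⟨?_, ?_⟩
      · exact (hu1 i).trans (gridPoint_mono hT.le hip)
      · have := Nat.lt_ceil.1 hpi
        rw [lt_div_iff₀ hpos] at this
        exact (coe_gridPoint hT.le hM hpm.le).trans_lt this
      · rw [← hj i hi.le]; exact j.monotone h1
      · rw [← hj (i + 1) hi]; exact j.strictMono h2
    · have hsT : (s : ℝ) = T := le_antisymm s.2.2 (huN.symm.trans_le hsN)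
      have hsu : s = u N := Subtype.ext (hsT.trans huN.symm)
      have htu : t N = u N := Subtype.ext (htN.trans huN.symm)
      have hgp : gridPoint hT.le m p = s := by
        rcases hpm.lt_or_eq with hpm | rfl
        · have h1 : (s : ℝ) < gridPoint hT.le m (p + 1) := hp2 hpm
          exact absurd h1 (not_lt.2 ((gridPoint hT.le m (p + 1)).2.2.trans_eq hsT.symm))
        · exact Subtype.ext ((coe_gridPoint_of_le hT.le hM le_rfl).trans hsT.symm)
      rw [hgp, hsu, hj N le_rfl, htu, edist_self]
      exact zero_le

end SkorokhodSpace

/-! ### Two measure inequalities -/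

/-- If every point of `E` lies in at least `D` of the sets `A i`, then `D * μ E` is at most the
sum of the measures of the `A i`. -/
lemma MeasureTheory.nsmul_measure_le_sum {Ω ι : Type*} {mΩ : MeasurableSpace Ω} (μ : Measure Ω)
    (F : Finset ι) (A : ι → Set Ω) {E : Set Ω} {D : ℕ}
    (h : ∀ ω ∈ E, ∃ G ⊆ F, D ≤ G.card ∧ ∀ i ∈ G, ω ∈ A i) :
    (D : ℝ≥0∞) * μ E ≤ ∑ i ∈ F, μ (A i) := by
  -- Markov's inequality for the number of events that occur; the measurable hulls allow arbitrary
  -- sets `A i`.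
  let g : Ω → ℝ≥0∞ := fun ω => ∑ i ∈ F, (toMeasurable μ (A i)).indicator 1 ω
  have hm : ∀ i ∈ F, Measurable ((toMeasurable μ (A i)).indicator (1 : Ω → ℝ≥0∞)) := fun i _ =>
    measurable_one.indicator (measurableSet_toMeasurable μ (A i))
  have hE : E ⊆ {ω | (D : ℝ≥0∞) ≤ g ω} := by
    intro ω hω
    obtain ⟨G, hGF, hD, hG⟩ := h ω hω
    calc (D : ℝ≥0∞) ≤ (G.card : ℝ≥0∞) := Nat.cast_le.2 hD
      _ = ∑ i ∈ G, (toMeasurable μ (A i)).indicator (1 : Ω → ℝ≥0∞) ω := by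
        rw [Finset.sum_congr rfl fun i hi =>
          Set.indicator_of_mem (subset_toMeasurable μ (A i) (hG i hi)) (1 : Ω → ℝ≥0∞)]
        simp
      _ ≤ g ω := Finset.sum_le_sum_of_subset hGF
  calc (D : ℝ≥0∞) * μ E ≤ D * μ {ω | (D : ℝ≥0∞) ≤ g ω} := by gcongr
    _ ≤ ∫⁻ ω, g ω ∂μ := mul_meas_ge_le_lintegral (Finset.measurable_fun_sum F hm) _
    _ = ∑ i ∈ F, μ (A i) := by
      rw [lintegral_finsetSum F hm]
      refine Finset.sum_congr rfl fun i _ => ?_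
      rw [lintegral_indicator_one (measurableSet_toMeasurable μ (A i)), measure_toMeasurable]

/-- If every point of `E` eventually lies in `A k`, then a bound for all `μ (A k)` bounds
`μ E`. -/
lemma MeasureTheory.measure_le_of_forall_eventually_mem {Ω : Type*} {mΩ : MeasurableSpace Ω}
    (μ : Measure Ω) {E : Set Ω} {A : ℕ → Set Ω} {c : ℝ≥0∞} (hA : ∀ k, μ (A k) ≤ c)
    (h : ∀ ω ∈ E, ∀ᶠ k in atTop, ω ∈ A k) : μ E ≤ c := by
  have hmono : Monotone fun n => ⋂ k ≥ n, A k := fun m n hmn =>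
    Set.biInter_mono (fun k hk => hmn.trans hk) fun _ _ => subset_rfl
  have hE : E ⊆ ⋃ n, ⋂ k ≥ n, A k := by
    intro ω hω
    obtain ⟨n, hn⟩ := eventually_atTop.1 (h ω hω)
    exact Set.mem_iUnion.2 ⟨n, Set.mem_iInter₂.2 hn⟩
  refine (measure_mono hE).trans ?_
  rw [hmono.measure_iUnion]
  exact iSup_le fun n => (measure_mono (Set.iInter₂_subset n le_rfl)).trans (hA n)

/-! ### Exit indices of a sequence -/

/-- The first index after `p` at which the sequence `z` has moved by at least `η` from `z p`, or
`M` if there is no such index below `M`. -/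
noncomputable def nextExit {H : Type*} [Dist H] (z : ℕ → H) (η : ℝ) (M p : ℕ) : ℕ :=
  sInf {r | (p < r ∧ η ≤ dist (z r) (z p)) ∨ M ≤ r}

/-- The successive exit indices of the sequence `z`, starting from `0`. -/
noncomputable def exitIndex {H : Type*} [Dist H] (z : ℕ → H) (η : ℝ) (M : ℕ) : ℕ → ℕ
  | 0 => 0
  | i + 1 => nextExit z η M (exitIndex z η M i)

section exit

variable {H : Type*} [PseudoMetricSpace H] {z : ℕ → H} {η : ℝ} {M : ℕ}

lemma nextExit_mem (z : ℕ → H) (η : ℝ) (M p : ℕ) :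
    (p < nextExit z η M p ∧ η ≤ dist (z (nextExit z η M p)) (z p)) ∨ M ≤ nextExit z η M p :=
  Nat.sInf_mem (s := {r | (p < r ∧ η ≤ dist (z r) (z p)) ∨ M ≤ r}) ⟨M, Or.inr le_rfl⟩

lemma nextExit_le (z : ℕ → H) (η : ℝ) (M p : ℕ) : nextExit z η M p ≤ M :=
  Nat.sInf_le (Or.inr le_rfl)

lemma le_nextExit {p : ℕ} (hp : p ≤ M) : p ≤ nextExit z η M p := by
  rcases nextExit_mem z η M p with h | h
  · exact h.1.le
  · exact hp.trans h

lemma dist_nextExit {p : ℕ} (h : nextExit z η M p < M) :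
    η ≤ dist (z (nextExit z η M p)) (z p) := by
  rcases nextExit_mem z η M p with h' | h'
  · exact h'.2
  · exact absurd h (not_lt.2 h')

lemma dist_lt_of_lt_nextExit (hη : 0 < η) {p r : ℕ} (hp : p ≤ r) (hr : r < nextExit z η M p) :
    dist (z r) (z p) < η := by
  rcases hp.eq_or_lt with rfl | hp
  · simpa using hη
  · by_contra h
    exact absurd hr (not_lt.2 (Nat.sInf_le (Or.inl ⟨hp, not_lt.1 h⟩)))

/-- Below `M` the default value plays no role, and the event depends only on the sequence up to `r`.
This makes exits of adapted processes stopping times. -/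
lemma nextExit_le_iff {p r : ℕ} (hr : r < M) :
    nextExit z η M p ≤ r ↔ ∃ k ≤ r, p < k ∧ η ≤ dist (z k) (z p) := by
  refine ⟨fun h => ⟨_, h, ?_⟩, fun ⟨k, hk, h⟩ => (Nat.sInf_le (Or.inl h)).trans hk⟩
  rcases nextExit_mem z η M p with h' | h'
  · exact h'
  · exact absurd (h'.trans h) (not_le.2 hr)

lemma exitIndex_le (z : ℕ → H) (η : ℝ) (M i : ℕ) : exitIndex z η M i ≤ M := by
  cases i with
  | zero => exact Nat.zero_le M
  | succ i => exact nextExit_le _ _ _ _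

lemma exitIndex_mono (z : ℕ → H) (η : ℝ) (M : ℕ) : Monotone (exitIndex z η M) :=
  monotone_nat_of_le_succ fun i => le_nextExit (exitIndex_le z η M i)

/-- If the sequence `z` reaches `M` in finitely many exits and makes no exit in fewer than `L`
steps, neither from the exit indices nor from the index `L / 2` before the end, then there is a
partition with gaps at least `L / 2` on whose half-open intervals `z` is almost constant. -/
lemma exists_partition_of_exitIndex (hη : 0 < η) {L q : ℕ} (hL : 0 < L) (hLM : L ≤ M)
    (hq : exitIndex z η M q = M)
    (hexit : ∀ i < q, exitIndex z η M (i + 1) < exitIndex z η M i + L →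
      dist (z (exitIndex z η M (i + 1))) (z (exitIndex z η M i)) < η)
    (hlast : nextExit z η M (M - (L + 1) / 2) < M - (L + 1) / 2 + L →
      dist (z (nextExit z η M (M - (L + 1) / 2))) (z (M - (L + 1) / 2)) < η) :
    ∃ (N : ℕ) (s : ℕ → ℕ), s 0 = 0 ∧ s N = M ∧ ∀ i < N, 2 * s i + L ≤ 2 * s (i + 1) ∧
      ∀ p, s i ≤ p → p < s (i + 1) → dist (z p) (z (s i)) < 2 * η := by
  -- The last exit index may be the default `M`, at a short distance from its predecessor. Exit
  -- indices beyond `m`, which is `L / 2` rounded up before the end, are therefore dropped and `M`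
  -- is appended.
  set m := M - (L + 1) / 2 with hm
  have hmM : m < M := by omega
  obtain ⟨n, hnq, hn1, hn2⟩ := exists_between_consecutive (t := exitIndex z η M) (N := q) (s := m)
    (Nat.zero_le m) (by rwa [hq])
  refine ⟨n + 1, fun i => if i ≤ n then exitIndex z η M i else M, by simp [exitIndex], by simp,
    fun i hi => ?_⟩
  rcases (Nat.lt_succ_iff.1 hi).lt_or_eq with hi | rfl
  · have hlt : exitIndex z η M (i + 1) < M :=
      ((exitIndex_mono z η M (Nat.succ_le_of_lt hi)).trans hn1).trans_lt hmM
    have h1 : ¬ exitIndex z η M (i + 1) < exitIndex z η M i + L := fun h =>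
      absurd (hexit i (hi.trans hnq) h) (not_lt.2 (dist_nextExit hlt))
    simp only [hi.le, Nat.succ_le_of_lt hi, if_true]
    refine ⟨by omega, fun p hp1 hp2 => ?_⟩
    exact (dist_lt_of_lt_nextExit hη hp1 hp2).trans (by linarith)
  · simp only [le_refl, if_true, Nat.not_succ_le_self, if_false]
    refine ⟨by omega, fun p hp1 hp2 => ?_⟩
    rcases le_or_gt p m with hpm | hpm
    · exact (dist_lt_of_lt_nextExit hη hp1 (hpm.trans_lt hn2)).trans (by linarith)
    -- An exit from `m` before `M` is genuine and takes fewer than `L` steps, which `hlast`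
    -- excludes.
    · have h1 : p < nextExit z η M m := by
        by_contra h
        refine absurd (hlast (by omega)) (not_lt.2 (dist_nextExit (by omega)))
      calc dist (z p) (z (exitIndex z η M i))
          ≤ dist (z p) (z m) + dist (z m) (z (exitIndex z η M i)) := dist_triangle _ _ _
        _ < η + η := add_lt_add (dist_lt_of_lt_nextExit hη hpm.le h1)
            (dist_lt_of_lt_nextExit hη hn1 hn2)
        _ = 2 * η := by ring

end exit

/-! ### Stopping times with values in a grid -/

lemma measurableSet_le_dist {Ω H : Type*} {_ : MeasurableSpace Ω} [PseudoMetricSpace H]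
    [SecondCountableTopology H] [MeasurableSpace H] [OpensMeasurableSpace H] {f g : Ω → H}
    (hf : Measurable f) (hg : Measurable g) (η : ℝ) : MeasurableSet {ω | η ≤ dist (f ω) (g ω)} :=
  measurableSet_le measurable_const (hf.dist hg)

/-- Random indices `N ≤ M` that make `gridPoint hT M N` a stopping time. -/
def IsGridTime {Ω : Type*} {mΩ : MeasurableSpace Ω} {T : ℝ} (hT : 0 ≤ T)
    (𝓕 : Filtration (Set.Icc (0 : ℝ) T) mΩ) (M : ℕ) (N : Ω → ℕ) : Prop :=
  (∀ ω, N ω ≤ M) ∧ ∀ p, MeasurableSet[𝓕 (gridPoint hT M p)] {ω | N ω ≤ p}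

section IsGridTime

variable {Ω : Type*} {mΩ : MeasurableSpace Ω} {T : ℝ} {hT : 0 ≤ T}
  {𝓕 : Filtration (Set.Icc (0 : ℝ) T) mΩ} {M : ℕ} {N : Ω → ℕ}

lemma isGridTime_const {k : ℕ} (hk : k ≤ M) : IsGridTime hT 𝓕 M fun _ => k :=
  ⟨fun _ => hk, fun _ => MeasurableSet.const _⟩

lemma IsGridTime.measurableSet_eq (hN : IsGridTime hT 𝓕 M N) (p : ℕ) :
    MeasurableSet[𝓕 (gridPoint hT M p)] {ω | N ω = p} := by
  cases p with
  | zero => simpa using hN.2 0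
  | succ p =>
    have : {ω | N ω = p + 1} = {ω | N ω ≤ p + 1} \ {ω | N ω ≤ p} := by
      ext ω
      simp only [Set.mem_ofPred_eq, Set.mem_sdiff]
      omega
    rw [this]
    exact (hN.2 (p + 1)).diff (𝓕.mono (gridPoint_mono hT p.le_succ) _ (hN.2 p))

lemma IsGridTime.isStoppingTime (hN : IsGridTime hT 𝓕 M N) :
    IsStoppingTime 𝓕 fun ω =>
      ((gridPoint hT M (N ω) : Set.Icc (0 : ℝ) T) : WithTop (Set.Icc (0 : ℝ) T)) := by
  intro t
  have : {ω | ((gridPoint hT M (N ω) : Set.Icc (0 : ℝ) T) : WithTop (Set.Icc (0 : ℝ) T)) ≤ t}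
      = ⋃ p, ⋃ _ : gridPoint hT M p ≤ t, {ω | N ω = p} := by
    ext ω
    simp
  rw [this]
  exact MeasurableSet.iUnion fun p => MeasurableSet.iUnion fun hp =>
    𝓕.mono hp _ (hN.measurableSet_eq p)

variable {H : Type*} [PseudoMetricSpace H] [SecondCountableTopology H] [MeasurableSpace H]
  [OpensMeasurableSpace H] {Y : Set.Icc (0 : ℝ) T → Ω → H}

/-- An exit by index `p < M` is decided by the starting index and the values of `Y` at grid points
up to `p`, all known by then. -/
lemma IsGridTime.nextExit (hY : Adapted 𝓕 Y) (hN : IsGridTime hT 𝓕 M N) (η : ℝ) :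
    IsGridTime hT 𝓕 M fun ω => nextExit (fun p => Y (gridPoint hT M p) ω) η M (N ω) := by
  refine ⟨fun ω => nextExit_le _ _ _ _, fun p => ?_⟩
  rcases le_or_gt M p with hp | hp
  · convert MeasurableSet.univ using 1
    ext ω
    simpa using (nextExit_le _ _ _ _).trans hp
  · have : {ω | _root_.nextExit (fun p => Y (gridPoint hT M p) ω) η M (N ω) ≤ p}
        = ⋃ k, ⋃ _ : k ≤ p, ⋃ r, ⋃ _ : r < k, {ω | N ω = r} ∩
          {ω | η ≤ dist (Y (gridPoint hT M k) ω) (Y (gridPoint hT M r) ω)} := by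
      ext ω
      simp only [Set.mem_ofPred_eq, nextExit_le_iff hp, Set.mem_iUnion, Set.mem_inter_iff,
        exists_prop]
      constructor
      · rintro ⟨k, hk, h1, h2⟩
        exact ⟨k, hk, N ω, h1, rfl, h2⟩
      · rintro ⟨k, hk, r, hr, rfl, h2⟩
        exact ⟨k, hk, hr, h2⟩
    rw [this]
    have hYm : ∀ k ≤ p, Measurable[𝓕 (gridPoint hT M p)] (Y (gridPoint hT M k)) := fun k hk =>
      (hY (gridPoint hT M k)).mono (𝓕.mono (gridPoint_mono hT hk)) le_rfl
    refine MeasurableSet.iUnion fun k => MeasurableSet.iUnion fun hk => MeasurableSet.iUnion fun r =>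
      MeasurableSet.iUnion fun hr => MeasurableSet.inter ?_ ?_
    · exact 𝓕.mono (gridPoint_mono hT (hr.le.trans hk)) _ (hN.measurableSet_eq r)
    · exact measurableSet_le_dist (hYm k hk) (hYm r (hr.le.trans hk)) η

lemma isGridTime_exitIndex (hY : Adapted 𝓕 Y) (η : ℝ) (i : ℕ) :
    IsGridTime hT 𝓕 M fun ω => exitIndex (fun p => Y (gridPoint hT M p) ω) η M i := by
  induction i with
  | zero => exact isGridTime_const (Nat.zero_le M)
  | succ i ih => exact ih.nextExit hY η

end IsGridTime

/-! ### Aldous's argument on grids -/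

section Aldous

variable {Ω : Type*} {mΩ : MeasurableSpace Ω} {T : ℝ} {P : Measure Ω}
  {𝓕 : Filtration (Set.Icc (0 : ℝ) T) mΩ} {H : Type*} [PseudoMetricSpace H]
  {Y : Set.Icc (0 : ℝ) T → Ω → H}

/-- If the increments of `Y` over short deterministic times after stopping times are small, then so
are the increments between two stopping times that are close to each other. -/
lemma measure_dist_le_of_isGridTime (hT : 0 < T) {M : ℕ} (hM : 0 < M) {δ η : ℝ} (hη : 0 < η)
    {ε : ℝ≥0∞}
    (h : ∀ N, IsGridTime hT.le 𝓕 M N → ∀ k : ℕ, 0 < k → k * (T / M) ≤ δ →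
      P {ω | η ≤ dist (Y (gridPoint hT.le M (N ω + k)) ω) (Y (gridPoint hT.le M (N ω)) ω)} ≤ ε)
    {N₁ N₂ : Ω → ℕ} (hN₁ : IsGridTime hT.le 𝓕 M N₁) (hN₂ : IsGridTime hT.le 𝓕 M N₂) :
    P {ω | N₁ ω ≤ N₂ ω ∧ ((N₂ ω - N₁ ω : ℕ) : ℝ) * (T / M) ≤ δ / 2 ∧
      2 * η ≤ dist (Y (gridPoint hT.le M (N₂ ω)) ω) (Y (gridPoint hT.le M (N₁ ω)) ω)} ≤
      3 * ε := by
  set E := {ω | N₁ ω ≤ N₂ ω ∧ ((N₂ ω - N₁ ω : ℕ) : ℝ) * (T / M) ≤ δ / 2 ∧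
      2 * η ≤ dist (Y (gridPoint hT.le M (N₂ ω)) ω) (Y (gridPoint hT.le M (N₁ ω)) ω)} with hE
  have hpos : 0 < T / M := div_pos hT (Nat.cast_pos.2 hM)
  -- `D` is the number of whole grid steps in `δ / 2`. Lags up to `D` after `N₂` are lags up to `2 *
  -- D` after `N₁`, so both stay within `δ`.
  set D := ⌊δ / 2 / (T / M)⌋₊ with hD
  let A : ℕ ⊕ ℕ → Set Ω := Sum.elim
    (fun k => {ω | η ≤ dist (Y (gridPoint hT.le M (N₁ ω + (k + 1))) ω)
      (Y (gridPoint hT.le M (N₁ ω)) ω)})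
    (fun k => {ω | η ≤ dist (Y (gridPoint hT.le M (N₂ ω + (k + 1))) ω)
      (Y (gridPoint hT.le M (N₂ ω)) ω)})
  have hgap : ∀ ω ∈ E, 0 < N₂ ω - N₁ ω ∧ N₂ ω - N₁ ω ≤ D := by
    rintro ω ⟨h1, h2, h3⟩
    refine ⟨Nat.pos_of_ne_zero fun h0 => ?_, Nat.le_floor ((le_div_iff₀ hpos).2 h2)⟩
    have h4 : N₂ ω = N₁ ω := by omega
    rw [h4, dist_self] at h3
    linarith
  rcases E.eq_empty_or_nonempty with h0 | ⟨ω₀, hω₀⟩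
  · simp [h0]
  have hD0 : 0 < D := (hgap ω₀ hω₀).1.trans_le (hgap ω₀ hω₀).2
  have hDδ : 2 * D * (T / M) ≤ δ := by
    have : (D : ℝ) ≤ δ / 2 / (T / M) := Nat.floor_le (Nat.pos_of_floor_pos hD0).le
    rw [le_div_iff₀ hpos] at this
    linarith
  have hk : ∀ k < 2 * D, ((k + 1 : ℕ) : ℝ) * (T / M) ≤ δ := fun k hk => by
    refine le_trans (mul_le_mul_of_nonneg_right ?_ hpos.le) hDδ
    exact_mod_cast hk
  have hcount := nsmul_measure_le_sum P ((Finset.range (2 * D)).disjSum (Finset.range D)) A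
    (E := E) (D := D) fun ω hω => by
      classical
      -- At index `N₂ ω + (k + 1)` the process is at least `η` away from its value at `N₁` or at
      -- `N₂`. `f` injectively selects an event that occurs, so `D` of the `3 * D` events do.
      let f : ℕ → ℕ ⊕ ℕ := fun k =>
        if ω ∈ A (Sum.inr k) then Sum.inr k else Sum.inl (N₂ ω - N₁ ω + k)
      refine ⟨(Finset.range D).image f, ?_, ?_, ?_⟩
      · intro i hi
        obtain ⟨k, hk, rfl⟩ := Finset.mem_image.1 hi
        have hk := Finset.mem_range.1 hk
        have := (hgap ω hω).2
        by_cases hkA : ω ∈ A (Sum.inr k)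
        · simpa [f, hkA] using hk
        · simp only [f, hkA, if_false, Finset.inl_mem_disjSum, Finset.mem_range]
          omega
      · rw [Finset.card_image_of_injective, Finset.card_range]
        intro a b hab
        by_cases ha : ω ∈ A (Sum.inr a) <;> by_cases hb : ω ∈ A (Sum.inr b) <;>
          grind
      · intro i hi
        obtain ⟨k, hk, rfl⟩ := Finset.mem_image.1 hi
        by_cases hkA : ω ∈ A (Sum.inr k)
        · simp only [f, hkA, if_true]
        · simp only [f, hkA, if_false]
          obtain ⟨h1, -, h3⟩ := hω
          have h4 : N₁ ω + (N₂ ω - N₁ ω + k + 1) = N₂ ω + (k + 1) := by omega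
          simp only [A, Sum.elim_inl, Sum.elim_inr, Set.mem_ofPred_eq, not_le, h4] at hkA ⊢
          have := dist_triangle_left (Y (gridPoint hT.le M (N₂ ω)) ω)
            (Y (gridPoint hT.le M (N₁ ω)) ω) (Y (gridPoint hT.le M (N₂ ω + (k + 1))) ω)
          linarith
  have hsum : ∑ i ∈ (Finset.range (2 * D)).disjSum (Finset.range D), P (A i) ≤ D * (3 * ε) := by
    rw [Finset.sum_disjSum]
    have h1 : ∑ k ∈ Finset.range (2 * D), P (A (Sum.inl k)) ≤ (2 * D : ℕ) * ε := by
      simpa using Finset.sum_le_card_nsmul (Finset.range (2 * D)) (fun k => P (A (Sum.inl k))) ε fun k hk' =>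
        h N₁ hN₁ (k + 1) k.succ_pos (hk k (Finset.mem_range.1 hk'))
    have h2 : ∑ k ∈ Finset.range D, P (A (Sum.inr k)) ≤ (D : ℕ) * ε := by
      simpa using Finset.sum_le_card_nsmul (Finset.range D) (fun k => P (A (Sum.inr k))) ε fun k hk' =>
        h N₂ hN₂ (k + 1) k.succ_pos (hk k (by have := Finset.mem_range.1 hk'; omega))
    refine (add_le_add h1 h2).trans (le_of_eq ?_)
    push_cast
    ring
  exact (ENNReal.mul_le_mul_iff_right (Nat.cast_ne_zero.2 hD0.ne') (ENNReal.natCast_ne_top D)).1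
    (hcount.trans hsum)

variable [SecondCountableTopology H] [MeasurableSpace H] [OpensMeasurableSpace H]

/-- Under the same assumption, many exits before the final time are unlikely. -/
lemma measure_exitIndex_lt (hT : 0 < T) (hY : Adapted 𝓕 Y) {M : ℕ} (hM : 0 < M) {δ η : ℝ}
    (hη : 0 < η) {ε : ℝ≥0∞}
    (h : ∀ N, IsGridTime hT.le 𝓕 M N → ∀ k : ℕ, 0 < k → k * (T / M) ≤ δ →
      P {ω | η ≤ dist (Y (gridPoint hT.le M (N ω + k)) ω) (Y (gridPoint hT.le M (N ω)) ω)} ≤ ε)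
    {m : ℕ} (hδ : 0 < δ) (hm : T ≤ m * (δ / 2)) :
    P {ω | exitIndex (fun p => Y (gridPoint hT.le M p) ω) (2 * η) M (2 * m) < M} ≤ 6 * ε := by
  classical
  have hM' : (0 : ℝ) < M := Nat.cast_pos.2 hM
  have hpos : 0 < T / M := div_pos hT hM'
  let τ : ℕ → Ω → ℕ := fun i ω => exitIndex (fun p => Y (gridPoint hT.le M p) ω) (2 * η) M i
  let A : ℕ → Set Ω := fun i => {ω | τ i ω ≤ τ (i + 1) ω ∧
    ((τ (i + 1) ω - τ i ω : ℕ) : ℝ) * (T / M) ≤ δ / 2 ∧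
      2 * η ≤ dist (Y (gridPoint hT.le M (τ (i + 1) ω)) ω) (Y (gridPoint hT.le M (τ i ω)) ω)}
  have hA : ∀ i, P (A i) ≤ 3 * ε := fun i =>
    measure_dist_le_of_isGridTime hT hM hη h (isGridTime_exitIndex hY _ i)
      (isGridTime_exitIndex hY _ (i + 1))
  have hm0 : 0 < m := Nat.pos_of_ne_zero fun h0 => by
    rw [h0, Nat.cast_zero, zero_mul] at hm
    linarith
  have hcount := nsmul_measure_le_sum P (Finset.range (2 * m)) A
    (E := {ω | τ (2 * m) ω < M}) (D := m) fun ω hω => by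
      have hmono : Monotone fun i => τ i ω := exitIndex_mono _ _ _
      refine ⟨(Finset.range (2 * m)).filter fun i => ω ∈ A i, Finset.filter_subset _ _, ?_,
        fun i hi => (Finset.mem_filter.1 hi).2⟩
      -- The gaps add up to at most `T ≤ m * (δ / 2)`, so at most `m` of the `2 * m` gaps are long
      -- and the other exits lie in `A`.
      have hlong : ∀ i ∈ (Finset.range (2 * m)).filter fun i => ¬ ω ∈ A i,
          δ / 2 ≤ ((τ (i + 1) ω : ℝ) - τ i ω) * (T / M) := by
        intro i hi
        obtain ⟨hi, hiA⟩ := Finset.mem_filter.1 hi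
        have hle : τ i ω ≤ τ (i + 1) ω := hmono i.le_succ
        have hexit : 2 * η ≤ dist (Y (gridPoint hT.le M (τ (i + 1) ω)) ω)
            (Y (gridPoint hT.le M (τ i ω)) ω) :=
          dist_nextExit ((hmono (Finset.mem_range.1 hi)).trans_lt hω)
        rw [← Nat.cast_sub hle]
        by_contra hlt
        exact hiA ⟨hle, (not_le.1 hlt).le, hexit⟩
      have hsum : ((Finset.range (2 * m)).filter fun i => ¬ ω ∈ A i).card * (δ / 2) ≤ T := by
        calc _ ≤ ∑ i ∈ (Finset.range (2 * m)).filter fun i => ¬ ω ∈ A i,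
              ((τ (i + 1) ω : ℝ) - τ i ω) * (T / M) := by
                simpa using Finset.card_nsmul_le_sum _ _ _ hlong
          _ ≤ ∑ i ∈ Finset.range (2 * m), ((τ (i + 1) ω : ℝ) - τ i ω) * (T / M) :=
            Finset.sum_le_sum_of_subset_of_nonneg (Finset.filter_subset _ _) fun i _ _ =>
              mul_nonneg (sub_nonneg.2 (Nat.cast_le.2 (hmono i.le_succ))) hpos.le
          _ = (τ (2 * m) ω : ℝ) * (T / M) := by
            rw [← Finset.sum_mul, Finset.sum_range_sub (fun i => (τ i ω : ℝ))]
            simp [τ, exitIndex]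
          _ ≤ M * (T / M) := by
            have : (τ (2 * m) ω : ℝ) ≤ M := Nat.cast_le.2 (exitIndex_le _ _ _ _)
            gcongr
          _ = T := mul_div_cancel₀ T hM'.ne'
      have hcard : ((Finset.range (2 * m)).filter fun i => ¬ ω ∈ A i).card ≤ m := by
        have := hsum.trans hm
        exact_mod_cast le_of_mul_le_mul_right this (half_pos hδ)
      have := Finset.card_filter_add_card_filter_not (s := Finset.range (2 * m)) fun i => ω ∈ A i
      rw [Finset.card_range] at this
      omega
  have hsum : ∑ i ∈ Finset.range (2 * m), P (A i) ≤ m * (6 * ε) := by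
    have := Finset.sum_le_card_nsmul (Finset.range (2 * m)) _ (3 * ε) fun i _ => hA i
    refine this.trans (le_of_eq ?_)
    simp only [Finset.card_range, nsmul_eq_mul]
    push_cast
    ring
  exact (ENNReal.mul_le_mul_iff_right (Nat.cast_ne_zero.2 hm0.ne') (ENNReal.natCast_ne_top m)).1
    (hcount.trans hsum)

/-- A sequence of adapted processes whose increments after stopping times are uniformly small has,
with high probability and uniformly along all grids, partitions of gap at least `δ` on whose
half-open intervals the processes are almost constant. -/
lemma exists_measure_forall_partition_le (hT : 0 < T) {X : ℕ → Set.Icc (0 : ℝ) T → Ω → H}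
    (hX : ∀ n, Adapted 𝓕 (X n))
    (h : ∀ ε : ℝ≥0∞, 0 < ε → ∀ η : ℝ, 0 < η → ∃ δ : ℝ, 0 < δ ∧ ∀ n, ∀ M : ℕ, 0 < M →
      ∀ N, IsGridTime hT.le 𝓕 M N → ∀ k : ℕ, 0 < k → k * (T / M) ≤ δ →
      P {ω | η ≤ dist (X n (gridPoint hT.le M (N ω + k)) ω)
        (X n (gridPoint hT.le M (N ω)) ω)} ≤ ε)
    {ε : ℝ≥0∞} (hε : 0 < ε) {η : ℝ} (hη : 0 < η) :
    ∃ δ : ℝ, 0 < δ ∧ ∀ n, ∀ M : ℕ, 0 < M →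
      P {ω | ¬ ∃ (N : ℕ) (s : ℕ → ℕ), s 0 = 0 ∧ s N = M ∧
        ∀ i < N, s i * (T / M) + δ ≤ s (i + 1) * (T / M) ∧ ∀ p, s i ≤ p → p < s (i + 1) →
          dist (X n (gridPoint hT.le M p) ω) (X n (gridPoint hT.le M (s i)) ω) < 4 * η} ≤ ε := by
  -- `δ₁` first bounds the number of exits by `2 * m`. Only then is `δ₂` chosen, sharing `ε / 2`
  -- among these exits and the exit from the index near the end.
  obtain ⟨δ₁, hδ₁, h₁⟩ := h (ε / 2 / 6)
    (ENNReal.div_pos (ENNReal.half_pos hε.ne').ne' (by norm_num)) η hη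
  obtain ⟨m, hm⟩ := exists_nat_ge (T / (δ₁ / 2))
  rw [div_le_iff₀ (half_pos hδ₁)] at hm
  obtain ⟨δ₂, hδ₂, h₂⟩ := h (ε / 2 / ((2 * m + 1 : ℕ) * 3))
    (ENNReal.div_pos (ENNReal.half_pos hε.ne').ne'
      (ENNReal.mul_ne_top (ENNReal.natCast_ne_top _) (by norm_num))) η hη
  -- Fewer than `L` grid steps take time at most `d ≤ δ₂ / 2`, while `d ≤ T / 2` ensures `L ≤ M`.
  set d := min (δ₂ / 2) (T / 2) with hd
  have hd0 : 0 < d := lt_min (half_pos hδ₂) (half_pos hT)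
  refine ⟨d / 2, half_pos hd0, fun n M hM => ?_⟩
  have hM' : (0 : ℝ) < M := Nat.cast_pos.2 hM
  have hpos : 0 < T / M := div_pos hT hM'
  set L := ⌊d / (T / M)⌋₊ + 1 with hL
  have hLM : L ≤ M := by
    refine Nat.succ_le_of_lt ((Nat.floor_lt (by positivity)).2 ?_)
    rw [div_lt_iff₀ hpos, mul_div_cancel₀ T hM'.ne']
    exact (min_le_right _ _).trans_lt (half_lt_self hT)
  have hdL : d ≤ L * (T / M) := by
    have := (Nat.lt_floor_add_one (d / (T / M))).le
    rw [div_le_iff₀ hpos] at this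
    exact_mod_cast this
  have hshort : ∀ a b : ℕ, b < a + L → ((b - a : ℕ) : ℝ) * (T / M) ≤ δ₂ / 2 := by
    intro a b hab
    have h1 : b - a ≤ ⌊d / (T / M)⌋₊ := by omega
    have h2 := (Nat.le_floor_iff (by positivity)).1 h1
    rw [le_div_iff₀ hpos] at h2
    exact h2.trans (min_le_left _ _)
  let τ : ℕ → Ω → ℕ := fun i ω => exitIndex (fun p => X n (gridPoint hT.le M p) ω) (2 * η) M i
  let e : Ω → ℕ := fun ω =>
    nextExit (fun p => X n (gridPoint hT.le M p) ω) (2 * η) M (M - (L + 1) / 2)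
  let S : (Ω → ℕ) → (Ω → ℕ) → Set Ω := fun N₁ N₂ => {ω | N₁ ω ≤ N₂ ω ∧
    ((N₂ ω - N₁ ω : ℕ) : ℝ) * (T / M) ≤ δ₂ / 2 ∧
      2 * η ≤ dist (X n (gridPoint hT.le M (N₂ ω)) ω) (X n (gridPoint hT.le M (N₁ ω)) ω)}
  have hS : ∀ N₁ N₂, IsGridTime hT.le 𝓕 M N₁ → IsGridTime hT.le 𝓕 M N₂ →
      P (S N₁ N₂) ≤ 3 * (ε / 2 / ((2 * m + 1 : ℕ) * 3)) := fun N₁ N₂ =>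
    measure_dist_le_of_isGridTime hT hM hη (h₂ n M hM)
  have hτ : ∀ i, IsGridTime hT.le 𝓕 M (τ i) := isGridTime_exitIndex (hX n) _
  have hc : IsGridTime hT.le 𝓕 M fun _ => M - (L + 1) / 2 := isGridTime_const (Nat.sub_le _ _)
  have hbad : {ω | ¬ ∃ (N : ℕ) (s : ℕ → ℕ), s 0 = 0 ∧ s N = M ∧
        ∀ i < N, s i * (T / M) + d / 2 ≤ s (i + 1) * (T / M) ∧ ∀ p, s i ≤ p → p < s (i + 1) →
          dist (X n (gridPoint hT.le M p) ω) (X n (gridPoint hT.le M (s i)) ω) < 4 * η} ⊆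
      {ω | τ (2 * m) ω < M} ∪
        ((⋃ i ∈ Finset.range (2 * m), S (τ i) (τ (i + 1))) ∪ S (fun _ => M - (L + 1) / 2) e) := by
    intro ω hω
    by_contra hgood
    simp only [Set.mem_union, Set.mem_iUnion, not_or, not_exists, Finset.mem_range] at hgood
    obtain ⟨hg1, hg2, hg3⟩ := hgood
    refine hω ?_
    obtain ⟨N, s, hs0, hsN, hs⟩ := exists_partition_of_exitIndex
      (z := fun p => X n (gridPoint hT.le M p) ω) (η := 2 * η) (M := M) (L := L) (q := 2 * m)
      (by linarith) (Nat.succ_pos _) hLM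
      (le_antisymm (exitIndex_le _ _ _ _) (not_lt.1 hg1))
      (fun i hi hlt => by
        by_contra hfar
        exact hg2 i hi ⟨exitIndex_mono _ _ _ i.le_succ, hshort _ _ hlt, not_lt.1 hfar⟩)
      (fun hlt => by
        by_contra hfar
        exact hg3 ⟨le_nextExit (Nat.sub_le _ _), hshort _ _ hlt, not_lt.1 hfar⟩)
    refine ⟨N, s, hs0, hsN, fun i hi => ⟨?_, fun p hp1 hp2 => ?_⟩⟩
    · have h1 : (2 * s i + L : ℝ) ≤ 2 * s (i + 1) := by exact_mod_cast (hs i hi).1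
      have h2 := mul_le_mul_of_nonneg_right h1 hpos.le
      linarith
    · exact ((hs i hi).2 p hp1 hp2).trans_eq (by ring)
  calc _ ≤ P ({ω | τ (2 * m) ω < M} ∪
        ((⋃ i ∈ Finset.range (2 * m), S (τ i) (τ (i + 1))) ∪ S (fun _ => M - (L + 1) / 2) e)) :=
        measure_mono hbad
    _ ≤ 6 * (ε / 2 / 6) + ((2 * m : ℕ) * (3 * (ε / 2 / ((2 * m + 1 : ℕ) * 3)))
        + 3 * (ε / 2 / ((2 * m + 1 : ℕ) * 3))) := by
      refine (measure_union_le _ _).trans (add_le_add ?_ ((measure_union_le _ _).trans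
        (add_le_add ?_ ?_)))
      · exact measure_exitIndex_lt hT (hX n) hM hη (h₁ n M hM) hδ₁ hm
      · refine (measure_biUnion_finset_le _ _).trans ?_
        simpa using Finset.sum_le_card_nsmul (Finset.range (2 * m)) _ _
          fun i _ => hS (τ i) (τ (i + 1)) (hτ i) (hτ (i + 1))
      · exact hS _ _ hc (hc.nextExit (hX n) _)
    _ = 6 * (ε / 2 / 6) + ((2 * m + 1 : ℕ) * 3) * (ε / 2 / ((2 * m + 1 : ℕ) * 3)) := by
      push_cast
      ring
    _ = ε / 2 + ε / 2 := by
      rw [ENNReal.mul_div_cancel (by norm_num) (by norm_num),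
        ENNReal.mul_div_cancel (mul_ne_zero (Nat.cast_ne_zero.2 (Nat.succ_ne_zero _)) (by norm_num))
          (ENNReal.mul_ne_top (ENNReal.natCast_ne_top _) (by norm_num))]
    _ = ε := ENNReal.add_halves ε

end Aldous

/-! ### The hypotheses in grid and compact form -/

/-- The Aldous condition, for stopping times with values in a grid and increments along the grid. -/
lemma AldousCondition.exists_measure_le {Ω H : Type*} {mΩ : MeasurableSpace Ω}
    [NormedAddCommGroup H] {T : ℝ} (hT : 0 < T) {P : Measure Ω} [IsFiniteMeasure P]
    {𝓕 : Filtration (Set.Icc (0 : ℝ) T) mΩ} {X : ℕ → Set.Icc (0 : ℝ) T → Ω → H}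
    (h : AldousCondition hT.le P 𝓕 X) {ε : ℝ≥0∞} (hε : 0 < ε) {η : ℝ} (hη : 0 < η) :
    ∃ δ : ℝ, 0 < δ ∧ ∀ n, ∀ M : ℕ, 0 < M →
      ∀ N, IsGridTime hT.le 𝓕 M N → ∀ k : ℕ, 0 < k → k * (T / M) ≤ δ →
      P {ω | η ≤ dist (X n (gridPoint hT.le M (N ω + k)) ω)
        (X n (gridPoint hT.le M (N ω)) ω)} ≤ ε := by
  obtain ⟨ε', hε', hle⟩ : ∃ ε' : ℝ, 0 < ε' ∧ ENNReal.ofReal ε' ≤ ε := by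
    obtain ⟨r, hr0, hr⟩ := ENNReal.lt_iff_exists_nnreal_btwn.1 hε
    exact ⟨r, by exact_mod_cast hr0, by simpa using hr.le⟩
  obtain ⟨δ, hδ, H⟩ := h ε' hε' η hη
  refine ⟨δ, hδ, fun n M hM N hN k hk hkδ => ?_⟩
  have hpos : 0 < T / M := div_pos hT (Nat.cast_pos.2 hM)
  have key := H (fun _ ω => gridPoint hT.le M (N ω)) (fun _ => hN.isStoppingTime) n
    (k * (T / M)) (mul_pos (Nat.cast_pos.2 hk) hpos) hkδ
  have heq : ∀ ω, Set.projIcc 0 T hT.le ((gridPoint hT.le M (N ω) : ℝ) + k * (T / M))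
      = gridPoint hT.le M (N ω + k) := fun ω => by
    rw [coe_gridPoint hT.le hM (hN.1 ω), ← add_mul, ← Nat.cast_add, gridPoint]
  simp only [heq, ← dist_eq_norm] at key
  exact ((ENNReal.le_ofReal_iff_toReal_le (measure_ne_top P _) hε'.le).2 key).trans hle

section Containment

variable {Ω H Γ : Type*} {mΩ : MeasurableSpace Ω} [NormedAddCommGroup H] [NormedSpace ℝ H]
  [MeasurableSpace H] [BorelSpace H] [NormedAddCommGroup Γ] [NormedSpace ℝ Γ] {T : ℝ}
  {P : Measure Ω} [IsProbabilityMeasure P] {i : Γ →ₗ[ℝ] H} {X : ℕ → Set.Icc (0 : ℝ) T → Ω → H}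

/-- Before the final time, containment in balls of a compactly embedded space gives compact
containment. -/
lemma BallContainment.exists_isCompact (hX : ∀ n t, Measurable (X n t))
    (hcadlag : ∀ n ω, IsCadlagOn fun t => X n t ω) (hi : IsCompactOperator i)
    (h : BallContainment P i X) {ε : ℝ≥0∞} (hε : 0 < ε) :
    ∃ C : Set H, IsCompact C ∧ ∀ n, ∀ t : Set.Icc (0 : ℝ) T, (t : ℝ) < T →
      P {ω | X n t ω ∉ C} ≤ ε := by
  obtain ⟨ε', hε', hle⟩ : ∃ ε' : ℝ, 0 < ε' ∧ ENNReal.ofReal ε' ≤ ε := by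
    obtain ⟨r, hr0, hr⟩ := ENNReal.lt_iff_exists_nnreal_btwn.1 hε
    exact ⟨r, by exact_mod_cast hr0, by simpa using hr.le⟩
  obtain ⟨R, hR, hball⟩ := h ε' hε'
  let C : Set H := closure (i '' Metric.closedBall 0 R)
  have hC : IsCompact C := hi.isCompact_closure_image_closedBall R
  have hq : ∀ (q : ℚ) (hq : (q : ℝ) ∈ Set.Icc (0 : ℝ) T) (n : ℕ),
      P {ω | X n ⟨(q : ℝ), hq⟩ ω ∉ C} ≤ ε := by
    intro q hq n
    have hm : MeasurableSet {ω | X n ⟨(q : ℝ), hq⟩ ω ∈ C} :=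
      hX n _ isClosed_closure.measurableSet
    have h1 : 1 - ε' ≤ P.real {ω | X n ⟨(q : ℝ), hq⟩ ω ∈ C} := by
      refine (hball q hq n).trans (measureReal_mono ?_)
      rintro ω ⟨g, hg, hgR⟩
      exact subset_closure ⟨g, by simpa using hgR, hg⟩
    have h2 : P.real {ω | X n ⟨(q : ℝ), hq⟩ ω ∉ C} ≤ ε' := by
      have := probReal_compl_eq_one_sub (μ := P) hm
      rw [Set.compl_ofPred] at this
      linarith
    exact ((ENNReal.le_ofReal_iff_toReal_le (measure_ne_top P _) hε'.le).2 h2).trans hle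
  refine ⟨C, hC, fun n t ht => ?_⟩
  -- Rational times in `(t, T)` decrease towards `t` as closely as needed. The complement of `C` is
  -- open, so a path outside `C` at `t` is eventually outside at these times. The argument needs
  -- room to the right of `t`, hence `t < T`.
  have hex : ∀ k : ℕ, ∃ q : ℚ, (t : ℝ) < q ∧ (q : ℝ) < min T (t + 1 / ((k : ℝ) + 1)) := fun k =>
    exists_rat_btwn (lt_min ht (by linarith [Nat.one_div_pos_of_nat (α := ℝ) (n := k)]))
  choose q hq1 hq2 using hex
  have hqT : ∀ k, (q k : ℝ) ∈ Set.Icc (0 : ℝ) T := fun k =>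
    ⟨t.2.1.trans (hq1 k).le, ((hq2 k).trans_le (min_le_left _ _)).le⟩
  have hlim : Tendsto (fun k => (⟨(q k : ℝ), hqT k⟩ : Set.Icc (0 : ℝ) T)) atTop (𝓝[≥] t) := by
    refine tendsto_nhdsWithin_iff.2 ⟨tendsto_subtype_rng.2 ?_, .of_forall fun k => (hq1 k).le⟩
    refine tendsto_of_tendsto_of_tendsto_of_le_of_le tendsto_const_nhds ?_ (fun k => (hq1 k).le)
      fun k => ((hq2 k).trans_le (min_le_right _ _)).le
    simpa using (tendsto_one_div_add_atTop_nhds_zero_nat (𝕜 := ℝ)).const_add (t : ℝ)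
  refine measure_le_of_forall_eventually_mem P (fun k => hq (q k) (hqT k) n) fun ω hω => ?_
  exact (((hcadlag n ω).1 t).tendsto.comp hlim).eventually
    (isClosed_closure.isOpen_compl.mem_nhds hω)

end Containment

/-! ### Measurability and tightness -/

namespace SkorokhodSpace

variable {Ω H : Type*} {mΩ : MeasurableSpace Ω} [PseudoMetricSpace H] {T : ℝ} {P : Measure Ω}
  {𝓕 : Filtration (Set.Icc (0 : ℝ) T) mΩ} {X : ℕ → Set.Icc (0 : ℝ) T → Ω → H}
  [SecondCountableTopology H] [MeasurableSpace H] [OpensMeasurableSpace H]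

/-- With high probability, and uniformly along all grids, the samples of the processes are
uniformly close to step functions with gaps at least `δ` and with values in a compact set. -/
lemma exists_measure_forall_stepsIn_le (hT : 0 < T) (hX : ∀ n, Adapted 𝓕 (X n))
    (h : ∀ ε : ℝ≥0∞, 0 < ε → ∀ η : ℝ, 0 < η → ∃ δ : ℝ, 0 < δ ∧ ∀ n, ∀ M : ℕ, 0 < M →
      ∀ N, IsGridTime hT.le 𝓕 M N → ∀ k : ℕ, 0 < k → k * (T / M) ≤ δ →
      P {ω | η ≤ dist (X n (gridPoint hT.le M (N ω + k)) ω)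
        (X n (gridPoint hT.le M (N ω)) ω)} ≤ ε)
    (hC : ∀ ε : ℝ≥0∞, 0 < ε → ∃ C : Set H, IsCompact C ∧ ∀ n, ∀ t : Set.Icc (0 : ℝ) T,
      (t : ℝ) < T → P {ω | X n t ω ∉ C} ≤ ε)
    {ε : ℝ≥0∞} (hε : 0 < ε) {η : ℝ} (hη : 0 < η) :
    ∃ δ : ℝ, 0 < δ ∧ ∃ C : Set H, IsCompact C ∧ ∀ n, ∀ M : ℕ, 0 < M →
      P {ω | ¬ ∃ y ∈ (stepsIn δ C : Set (SkorokhodSpace T H)), ∀ s,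
        edist ((sample hT.le M fun t => X n t ω).toFun s) (y.toFun s) ≤ ENNReal.ofReal η} ≤ ε := by
  obtain ⟨δ, hδ, hpart⟩ := exists_measure_forall_partition_le hT hX h (ENNReal.half_pos hε.ne')
    (η := η / 8) (by positivity)
  -- Compact containment is not available at `T`. The increment over the last step of a fixed grid
  -- of mesh at most `δ'` keeps the value at `T` within `η` of one that is in `C`.
  obtain ⟨δ', hδ', hjump⟩ := h (ε / 2 / 2) (ENNReal.half_pos (ENNReal.half_pos hε.ne').ne') η hη
  -- Each partition interval has length at least `δ`, so it contains some `j * δ` with `j < J`, and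
  -- also its rounding down to the grid. Thus `C` is needed at `J` times, and once more before `T`,
  -- a number independent of `M`.
  set J := ⌊T / δ⌋₊ + 1 with hJ
  obtain ⟨C, hCc, hCP⟩ := hC (ε / 2 / 2 / (J + 1 : ℕ)) (ENNReal.div_pos
    (ENNReal.half_pos (ENNReal.half_pos hε.ne').ne').ne' (ENNReal.natCast_ne_top _))
  obtain ⟨m, hm⟩ := exists_nat_ge (T / δ')
  have hm0 : 0 < m := Nat.cast_pos.1 ((div_pos hT hδ').trans_le hm)
  have hm' : (0 : ℝ) < m := Nat.cast_pos.2 hm0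
  have hmδ : ((1 : ℕ) : ℝ) * (T / m) ≤ δ' := by
    rw [Nat.cast_one, one_mul, div_le_iff₀ hm', mul_comm, ← div_le_iff₀ hδ']
    exact hm
  refine ⟨δ, hδ, C, hCc, fun n M hM => ?_⟩
  have hM' : (0 : ℝ) < M := Nat.cast_pos.2 hM
  have hpos : 0 < T / M := div_pos hT hM'
  let f : ℕ → ℕ := fun j => ⌊j * δ / (T / M)⌋₊
  have hf : ∀ j, (f j : ℝ) * (T / M) ≤ j * δ := fun j => by
    rw [← le_div_iff₀ hpos]
    exact Nat.floor_le (by positivity)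
  have hMT : (M : ℝ) * (T / M) = T := mul_div_cancel₀ T hM'.ne'
  let B₀ : Set Ω := {ω | ¬ ∃ (N : ℕ) (s : ℕ → ℕ), s 0 = 0 ∧ s N = M ∧
    ∀ i < N, s i * (T / M) + δ ≤ s (i + 1) * (T / M) ∧ ∀ p, s i ≤ p → p < s (i + 1) →
      dist (X n (gridPoint hT.le M p) ω) (X n (gridPoint hT.le M (s i)) ω) < 4 * (η / 8)}
  let B₁ : ℕ → Set Ω := fun j => {ω | f j < M ∧ X n (gridPoint hT.le M (f j)) ω ∉ C}
  let B₂ : Set Ω := {ω | η ≤ dist (X n (gridPoint hT.le m (m - 1 + 1)) ω)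
        (X n (gridPoint hT.le m (m - 1)) ω)}
  let B₃ : Set Ω := {ω | X n (gridPoint hT.le m (m - 1)) ω ∉ C}
  have hltT : ∀ {M p : ℕ}, 0 < M → p < M → (gridPoint hT.le M p : ℝ) < T := fun hM hp =>
    (Subtype.coe_lt_coe.2 (gridPoint_lt hT hM hp hp)).trans_eq (coe_gridPoint_of_le hT.le hM le_rfl)
  have hbad : {ω | ¬ ∃ y ∈ (stepsIn δ C : Set (SkorokhodSpace T H)), ∀ s,
        edist ((sample hT.le M fun t => X n t ω).toFun s) (y.toFun s) ≤ ENNReal.ofReal η} ⊆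
      B₀ ∪ (B₂ ∪ ((⋃ j ∈ Finset.range J, B₁ j) ∪ B₃)) := by
    intro ω hω
    by_contra hgood
    simp only [Set.mem_union, Set.mem_iUnion, not_or, not_exists, Finset.mem_range] at hgood
    obtain ⟨hg0, hg2, hg1, hg3⟩ := hgood
    refine hω ?_
    obtain ⟨N, s, hs0, hsN, hs⟩ := not_not.1 hg0
    have hslt : ∀ i < N, s i < s (i + 1) := fun i hi => by
      have : (s i : ℝ) * (T / M) < s (i + 1) * (T / M) := by linarith [(hs i hi).1]
      exact Nat.cast_lt.1 (lt_of_mul_lt_mul_right this hpos.le)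
    have hsM : ∀ i ≤ N, s i ≤ M := fun i hi => hsN ▸ le_of_lt_consecutive hslt hi le_rfl
    have hval : ∀ i < N, ∃ c ∈ C, ∀ p, s i ≤ p → p < s (i + 1) →
        dist (X n (gridPoint hT.le M p) ω) c ≤ η := by
      intro i hi
      have hsT : (s (i + 1) : ℝ) * (T / M) ≤ T := by
        exact (mul_le_mul_of_nonneg_right (Nat.cast_le.2 (hsM (i + 1) hi)) hpos.le).trans_eq hMT
      set j := ⌈(s i : ℝ) * (T / M) / δ⌉₊ with hj
      have hj1 : (s i : ℝ) * (T / M) ≤ j * δ := by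
        rw [← div_le_iff₀ hδ]
        exact Nat.le_ceil _
      have hj2 : j * δ < s i * (T / M) + δ := by
        have := Nat.ceil_lt_add_one (a := (s i : ℝ) * (T / M) / δ) (by positivity)
        calc j * δ < ((s i : ℝ) * (T / M) / δ + 1) * δ := mul_lt_mul_of_pos_right this hδ
          _ = s i * (T / M) + δ := by field_simp
      have hj3 : j * δ < s (i + 1) * (T / M) := hj2.trans_le (hs i hi).1
      have hjJ : j < J := by
        refine Nat.lt_succ_of_le (Nat.le_floor ?_)
        rw [le_div_iff₀ hδ]
        exact (hj3.trans_le hsT).le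
      have hf1 : s i ≤ f j := Nat.le_floor ((le_div_iff₀ hpos).2 hj1)
      have hf2 : f j < s (i + 1) :=
        Nat.cast_lt.1 (lt_of_mul_lt_mul_right ((hf j).trans_lt hj3) hpos.le)
      have hfC : X n (gridPoint hT.le M (f j)) ω ∈ C := by
        by_contra hnot
        exact hg1 j hjJ ⟨hf2.trans_le (hsM (i + 1) hi), hnot⟩
      refine ⟨_, hfC, fun p hp1 hp2 => ?_⟩
      have h1 := (hs i hi).2 p hp1 hp2
      have h2 := (hs i hi).2 (f j) hf1 hf2
      have := dist_triangle_right (X n (gridPoint hT.le M p) ω)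
        (X n (gridPoint hT.le M (f j)) ω) (X n (gridPoint hT.le M (s i)) ω)
      linarith
    have hlast : ∃ c ∈ C, dist (X n (gridPoint hT.le M M) ω) c ≤ η := by
      refine ⟨_, not_not.1 hg3, ?_⟩
      have : gridPoint hT.le M M = gridPoint hT.le m (m - 1 + 1) := by
        rw [Nat.sub_add_cancel hm0]
        exact Subtype.ext ((coe_gridPoint_of_le hT.le hM le_rfl).trans
          (coe_gridPoint_of_le hT.le hm0 le_rfl).symm)
      rw [this]
      exact (not_le.1 hg2).le
    obtain ⟨cT, hcT, hcT'⟩ := hlast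
    have hval' : ∀ i, ∃ c ∈ C, i < N → ∀ p, s i ≤ p → p < s (i + 1) →
        dist (X n (gridPoint hT.le M p) ω) c ≤ η := fun i => by
      by_cases hi : i < N
      · obtain ⟨c, hc, hc'⟩ := hval i hi
        exact ⟨c, hc, fun _ => hc'⟩
      · exact ⟨cT, hcT, fun h => absurd h hi⟩
    choose v hv hv' using hval'
    let t : ℕ → Set.Icc (0 : ℝ) T := fun i => gridPoint hT.le M (s i)
    have ht : ∀ i ≤ N, (t i : ℝ) = s i * (T / M) := fun i hi => coe_gridPoint hT.le hM (hsM i hi)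
    have htlt : ∀ i < N, t i < t (i + 1) := fun i hi =>
      gridPoint_lt hT hM (hslt i hi) ((hslt i hi).trans_le (hsM (i + 1) hi))
    have htN : (t N : ℝ) = T := by rw [ht N le_rfl, hsN, hMT]
    refine ⟨step N t fun i => if i < N then v i else cT,
      ⟨N, t, _, by simp [ht, hs0], htN, fun i hi => ?_, fun i => ?_, rfl⟩, fun a => ?_⟩
    · rw [ht i hi.le, ht (i + 1) hi]
      exact (hs i hi).1
    · split_ifs
      exacts [hv i, hcT]
    · rw [edist_dist]
      refine ENNReal.ofReal_le_ofReal ?_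
      obtain ⟨p, hpM, hpa, hp1, hp2⟩ := sample_apply hT hM (fun t => X n t ω) a
      rw [hpa]
      rcases lt_or_ge a (t N) with haN | haN
      · obtain ⟨i, hi, h1, h2⟩ := exists_between_consecutive
          (show t 0 ≤ a from (show (t 0 : ℝ) = 0 by simp [ht, hs0]).trans_le a.2.1) haN
        have hpM : p < M := by
          refine hpM.lt_of_ne fun h => ?_
          rw [h] at hp1
          exact absurd haN (not_lt.2 ((congrArg (gridPoint hT.le M) hsN).trans_le hp1))
        simp only [step, countLE_eq htlt hi h1 h2, hi, if_true]
        exact hv' i hi p (Nat.lt_succ_iff.1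
          ((gridPoint_mono hT.le).reflect_lt (h1.trans_lt (hp2 hpM))))
          ((gridPoint_mono hT.le).reflect_lt (hp1.trans_lt h2))
      · have haT : (a : ℝ) = T := le_antisymm a.2.2 (htN.symm.trans_le haN)
        have hpM : p = M := by
          refine hpM.antisymm (not_lt.1 fun h => ?_)
          have h1 : (a : ℝ) < gridPoint hT.le M (p + 1) := hp2 h
          exact absurd h1 (not_lt.2 ((gridPoint hT.le M (p + 1)).2.2.trans_eq haT.symm))
        simpa [step, countLE_eq_last htlt haN, hpM] using hcT'
  have hB₁ : ∀ j ∈ Finset.range J, P (B₁ j) ≤ ε / 2 / 2 / (J + 1 : ℕ) := fun j _ => by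
    by_cases hj : f j < M
    · exact (measure_mono fun ω hω => hω.2).trans (hCP n _ (hltT hM hj))
    · simp [B₁, hj]
  calc _ ≤ P (B₀ ∪ (B₂ ∪ ((⋃ j ∈ Finset.range J, B₁ j) ∪ B₃))) := measure_mono hbad
    _ ≤ ε / 2 + (ε / 2 / 2 + (J * (ε / 2 / 2 / (J + 1 : ℕ)) + ε / 2 / 2 / (J + 1 : ℕ))) := by
      refine (measure_union_le _ _).trans (add_le_add (hpart n M hM) ((measure_union_le _ _).trans
        (add_le_add ?_ ((measure_union_le _ _).trans (add_le_add ?_ ?_)))))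
      · exact hjump n m hm0 _ (isGridTime_const (Nat.sub_le m 1)) 1 one_pos hmδ
      · refine (measure_biUnion_finset_le _ _).trans ?_
        simpa using Finset.sum_le_card_nsmul (Finset.range J) _ _ hB₁
      · exact hCP n _ (hltT hm0 (Nat.sub_lt hm0 one_pos))
    _ = ε / 2 + (ε / 2 / 2 + (J + 1 : ℕ) * (ε / 2 / 2 / (J + 1 : ℕ))) := by
      push_cast
      ring
    _ = ε := by
      rw [ENNReal.mul_div_cancel (Nat.cast_ne_zero.2 (Nat.succ_ne_zero _))
        (ENNReal.natCast_ne_top _), ENNReal.add_halves, ENNReal.add_halves]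

/-- Samples are continuous functions of measurable values, and the path is their pointwise limit in
the Skorokhod space. -/
lemma measurable_mk (hT : 0 < T) {Y : Set.Icc (0 : ℝ) T → Ω → H} (hY : ∀ t, Measurable (Y t))
    (hcadlag : ∀ ω, IsCadlagOn fun t => Y t ω) :
    Measurable fun ω => (⟨fun t => Y t ω, hcadlag ω⟩ : SkorokhodSpace T H) := by
  refine measurable_of_tendsto_metrizable (f := fun M ω => sample hT.le (M + 1) fun t => Y t ω)
    (fun M => ?_) (tendsto_pi_nhds.2 fun ω => tendsto_sample hT ⟨fun t => Y t ω, hcadlag ω⟩)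
  exact (continuous_step _ _).measurable.comp (measurable_pi_lambda _ fun p => hY _)

/-- Tightness of a sequence of processes with càdlàg paths, when the increments after stopping
times are small and the marginals are contained in compact sets. -/
theorem isTightMeasureSet_range_map [CompleteSpace H] [IsFiniteMeasure P] (hT : 0 < T)
    (hX : ∀ n, Adapted 𝓕 (X n)) (hcadlag : ∀ n ω, IsCadlagOn fun t => X n t ω)
    (h : ∀ ε : ℝ≥0∞, 0 < ε → ∀ η : ℝ, 0 < η → ∃ δ : ℝ, 0 < δ ∧ ∀ n, ∀ M : ℕ, 0 < M →
      ∀ N, IsGridTime hT.le 𝓕 M N → ∀ k : ℕ, 0 < k → k * (T / M) ≤ δ →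
      P {ω | η ≤ dist (X n (gridPoint hT.le M (N ω + k)) ω)
        (X n (gridPoint hT.le M (N ω)) ω)} ≤ ε)
    (hC : ∀ ε : ℝ≥0∞, 0 < ε → ∃ C : Set H, IsCompact C ∧ ∀ n, ∀ t : Set.Icc (0 : ℝ) T,
      (t : ℝ) < T → P {ω | X n t ω ∉ C} ≤ ε) :
    IsTightMeasureSet (Set.range fun n =>
      P.map fun ω => (⟨fun t => X n t ω, hcadlag n ω⟩ : SkorokhodSpace T H)) := by
  refine isTightMeasureSet_iff_exists_isCompact_measure_compl_le.2 fun ε hε => ?_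
  obtain ⟨ε', hε', hsum⟩ := ENNReal.exists_pos_sum_of_countable' hε.ne' ℕ
  choose δ hδ C hCc hP using fun k => exists_measure_forall_stepsIn_le hT hX h hC (hε' k)
    (η := 1 / ((k : ℝ) + 1)) Nat.one_div_pos_of_nat
  let K : Set (SkorokhodSpace T H) := {x | ∀ k, ∃ y ∈ stepsIn (δ k) (C k),
    ∀ s, edist (x.toFun s) (y.toFun s) ≤ ENNReal.ofReal (1 / ((k : ℝ) + 1))}
  have hK : IsCompact K := isCompact_setOf_forall_exists_stepsIn hδ hCc (by
    simpa using ENNReal.tendsto_ofReal (tendsto_one_div_add_atTop_nhds_zero_nat (𝕜 := ℝ)))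
  -- The closure provides a Borel set with open complement, so a path outside it has all fine
  -- samples outside `K`.
  refine ⟨closure K, hK.closure, ?_⟩
  rintro _ ⟨n, rfl⟩
  have hmeas := measurable_mk hT (fun t => (hX n t).mono (𝓕.le t) le_rfl) (hcadlag n)
  rw [Measure.map_apply hmeas isClosed_closure.measurableSet.compl]
  refine measure_le_of_forall_eventually_mem P
    (A := fun M => {ω | (sample hT.le (M + 1) fun t => X n t ω) ∉ K}) (fun M => ?_) fun ω hω => ?_
  · have : {ω | (sample hT.le (M + 1) fun t => X n t ω) ∉ K} ⊆
        ⋃ k, {ω | ¬ ∃ y ∈ (stepsIn (δ k) (C k) : Set (SkorokhodSpace T H)), ∀ s,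
          edist ((sample hT.le (M + 1) fun t => X n t ω).toFun s) (y.toFun s) ≤
            ENNReal.ofReal (1 / ((k : ℝ) + 1))} := fun ω hω => by
      obtain ⟨k, hk⟩ := not_forall.1 hω
      exact Set.mem_iUnion.2 ⟨k, hk⟩
    exact (measure_mono this).trans ((measure_iUnion_le _).trans
      ((ENNReal.tsum_le_tsum fun k => hP k n (M + 1) M.succ_pos).trans hsum.le))
  · filter_upwards [(tendsto_sample hT ⟨fun t => X n t ω, hcadlag n ω⟩).eventually
      (isClosed_closure.isOpen_compl.mem_nhds hω)] with M hM hMK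
    exact hM (subset_closure hMK)

end SkorokhodSpace

theorem mainTheorem6 {Ω H Γ : Type*} {mΩ : MeasurableSpace Ω}
    [NormedAddCommGroup H] [InnerProductSpace ℝ H] [CompleteSpace H]
    [TopologicalSpace.SeparableSpace H] [MeasurableSpace H] [BorelSpace H]
    [NormedAddCommGroup Γ] [NormedSpace ℝ Γ]
    (T : ℝ) (hT : 0 < T)
    (P : Measure Ω) [IsProbabilityMeasure P]
    (𝓕 : Filtration (Set.Icc (0 : ℝ) T) mΩ)
    (X : ℕ → Set.Icc (0 : ℝ) T → Ω → H)
    (hadapted : ∀ n, Adapted 𝓕 (X n))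
    (hcadlag : ∀ n ω, IsCadlagOn fun t => X n t ω)
    (i : Γ →ₗ[ℝ] H) (hinj : Function.Injective i) (hcompact : IsCompactOperator i)
    (hcontainment : BallContainment P i X)
    (haldous : AldousCondition hT.le P 𝓕 X) :
    (∀ n, Measurable fun ω => (⟨fun t => X n t ω, hcadlag n ω⟩ : SkorokhodSpace T H)) ∧
      IsTightMeasureSet (Set.range fun n =>
        P.map fun ω => (⟨fun t => X n t ω, hcadlag n ω⟩ : SkorokhodSpace T H)) := by
  have : SecondCountableTopology H := UniformSpace.secondCountable_of_separable H
  have hmeas : ∀ n t, Measurable (X n t) := fun n t => (hadapted n t).mono (𝓕.le t) le_rfl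
  exact ⟨fun n => SkorokhodSpace.measurable_mk hT (hmeas n) (hcadlag n),
    SkorokhodSpace.isTightMeasureSet_range_map hT hadapted hcadlag
      (fun _ hε _ hη => haldous.exists_measure_le hT hε hη)
      (fun _ hε => hcontainment.exists_isCompact hmeas hcadlag hcompact hε)⟩
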